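/- **Theorem 2.1 (Classical solution).** Let $\hbar>0$, $n\in\mathbb N$, let $V:\hbar\mathbb Z^n\to[0,\infty)$, and let $$\mathcal H_{\hbar,V}u(k)=-\hbar^{-2}\Big(\sum_{j=1}^n\big(u(k+\hbar v_j)+u(k-\hbar v_j)\big)-2n\,u(k)\Big)+V(k)u(k),\qquad k\in\hbar\mathbb Z^n,$$ where $v_j$ is the $j$-th standard basis vector, be the discrete Schrödinger operator, regarded as a non-negative self-adjoint operator in $\ell^2(\hbar\mathbb Z^n)$ with domain $\{u\in\ell^2: (I+\mathcal H_{\hbar,V})u\in\ell^2\}$. Let $\mathrm H^{\infty}=\bigcap_k \mathrm{Dom}(\mathcal H_{\hbar,V}^k)$, with the Fréchet topology given by the norms $\max_{j\le k}\|(I+\mathcal H_{\hbar,V})^ju\|_{\ell^2}$, $k\in\mathbb N_0$, and let $\mathrm H^{-\infty}$ be the space of continuous (conjugate-linear) functionals on $\mathrm H^\infty$, in which $\ell^2$ is embedded by the pairing $(w,\varphi)=\sum_k w(k)\overline{\varphi(k)}$; $\mathcal H_{\hbar,V}$ and the powers $(I+\mathcal H_{\hbar,V})^r$, $r\in\mathbb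 R$, act on $\mathrm H^{-\infty}$ by duality. For $s\in\mathbb R$ put $$\mathrm H^s=\{w\in \mathrm H^{-\infty}:(I+\mathcal H_{\hbar,V})^{s/2}w\in\ell^2(\hbar\mathbb Z^n)\},\qquad \|w\|_{\mathrm H^s}=\|(I+\mathcal H_{\hbar,V})^{s/2}w\|_{\ell^2}.$$ Let $T>0$, $s\in\mathbb R$ and $f\in L^2([0,T];\mathrm H^s)$. Let $a:[0,T]\to\mathbb R$ belong to $L^\infty_1([0,T])$ (that is, $a$ is absolutely continuous with $a,a'\in L^\infty([0,T])$), with $\inf_{t\in[0,T]}a(t)=a_0>0$, let $q\in L^\infty([0,T])$ be real-valued, and let $(u_0,u_1)\in \mathrm H^{1+s}\times \mathrm H^s$. Then the Cauchy problem $$u_{tt}+a(t)\mathcal H_{\hbar,V}u+q(t)u=f\ \text{ on }(0,T]\times\hbar\mathbb Z^n,\qquad u(0)=u_0,\quad u_t(0)=u_1,$$ has a unique solution $u\in C([0,T];\mathrm H^{1+s})\cap C^1([0,T];\mathrm H^s)$, where the equation is understood in $\mathrm H^{-\infty}$ for almost every $t$: for every $\varphi\in \mathrm H^\infty$ the function $t\mapsto(u_t(t),\varphi)$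 is absolutely continuous on $[0,T]$, and for almost every $t$ $$\tfrac{d}{dt}(u_t(t),\varphi)+a(t)(\mathcal H_{\hbar,V}u(t),\varphi)+q(t)(u(t),\varphi)=(f(t),\varphi).$$ Moreover, for all $t\in[0,T]$, $$\|u(t)\|^2_{\mathrm H^{1+s}}+\|u_t(t)\|^2_{\mathrm H^{s}}\le C_T\Big(\|u_0\|^2_{\mathrm H^{1+s}}+\|u_1\|^2_{\mathrm H^{s}}+\|f\|^2_{L^2([0,T];\mathrm H^{s})}\Big),$$ where $$C_T=c_0^{-1}\big(1+\|a\|_{L^\infty}\big)\exp\!\Big(c_0^{-1}\big(1+\|a'\|_{L^\infty}+\|q\|_{L^\infty}+2\|a\|_{L^\infty}\big)T\Big),\qquad c_0=\min\{a_0,1\}.$$ -/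

import Mathlib

open MeasureTheory Set
open scoped NNReal ENNReal InnerProductSpace

noncomputable section

namespace DiscreteSchrodinger

/-! ### The lattice and the discrete Schrödinger operator -/

/-- The lattice `ħℤⁿ = {ħ m : m ∈ ℤⁿ}` as an additive subgroup of `ℝⁿ`. -/
def lattice (n : ℕ) (ħ : ℝ) : AddSubgroup (Fin n → ℝ) where
  carrier := {x | ∃ m : Fin n → ℤ, x = ħ • fun j => (m j : ℝ)}
  zero_mem' := ⟨0, by ext j; simp⟩
  add_mem' := by
    rintro _ _ ⟨m, rfl⟩ ⟨m', rfl⟩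
    exact ⟨m + m', by ext j; simp [mul_add]⟩
  neg_mem' := by
    rintro _ ⟨m, rfl⟩
    exact ⟨-m, by ext j; simp⟩

variable {n : ℕ} {ħ : ℝ}

/-- The lattice vector `ħ vⱼ`, with `vⱼ` the `j`-th standard basis vector. -/
def step (j : Fin n) : lattice n ħ :=
  ⟨ħ • Pi.single j 1, Pi.single j 1, by
    congr 1; ext i; by_cases h : i = j
    · subst h; simp
    · simp [h]⟩

/-- The discrete Laplacian
`𝓛 u (k) = ∑ⱼ (u (k + ħ vⱼ) + u (k - ħ vⱼ)) - 2 n u (k)`, on all functions on the lattice. -/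
def laplacian : Module.End ℂ (lattice n ħ → ℂ) where
  toFun u k := ∑ j, (u (k + step j) + u (k - step j)) - 2 * (n : ℂ) * u k
  map_add' u v := by
    ext k; simp only [Pi.add_apply, Finset.sum_add_distrib]; ring
  map_smul' c u := by
    ext k; simp only [Pi.smul_apply, smul_eq_mul, RingHom.id_apply, mul_sub, Finset.mul_sum,
      mul_add]; ring

/-- The discrete Schrödinger operator `𝓗 u (k) = -ħ⁻² 𝓛 u (k) + V (k) u (k)` with potential
`V ≥ 0`, on all functions on the lattice. -/
def hamiltonian (V : lattice n ħ → ℝ≥0) : Module.End ℂ (lattice n ħ → ℂ) where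
  toFun u k := -((ħ : ℂ) ^ 2)⁻¹ * laplacian u k + ((V k : ℝ) : ℂ) * u k
  map_add' u v := by ext k; simp only [map_add, Pi.add_apply]; ring
  map_smul' c u := by
    ext k; simp only [map_smul, Pi.smul_apply, smul_eq_mul, RingHom.id_apply]; ring

/-- The Hilbert space `ℓ²(ħℤⁿ)`. -/
abbrev L2 (n : ℕ) (ħ : ℝ) : Type := lp (fun _ : lattice n ħ => ℂ) 2

/-! ### The resolvent `(I + 𝓗)⁻¹` -/

lemma two_toReal_pos : 0 < (2 : ℝ≥0∞).toReal := by norm_num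

lemma memlp_comp (e : lattice n ħ ≃ lattice n ħ) (u : L2 n ħ) :
    Memℓp (fun k => (u : lattice n ħ → ℂ) (e k)) 2 :=
  memℓp_gen (((lp.memℓp u).summable two_toReal_pos).comp_injective e.injective)

/-- Composition with a permutation of the lattice, on `ℓ²`. -/
def permOp (e : lattice n ħ ≃ lattice n ħ) : L2 n ħ →L[ℂ] L2 n ħ :=
  LinearMap.mkContinuous
    { toFun := fun u => ⟨fun k => (u : lattice n ħ → ℂ) (e k), memlp_comp e u⟩
      map_add' := fun _ _ => rfl
      map_smul' := fun _ _ => rfl } 1 (fun u => by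
      rw [one_mul, lp.norm_eq_tsum_rpow two_toReal_pos, lp.norm_eq_tsum_rpow two_toReal_pos]
      exact le_of_eq (congrArg (fun x : ℝ => x ^ (1 / (2 : ℝ≥0∞).toReal))
        (e.tsum_eq (fun k => ‖(u : lattice n ħ → ℂ) k‖ ^ (2 : ℝ≥0∞).toReal))))

lemma permOp_apply (e : lattice n ħ ≃ lattice n ħ) (u : L2 n ħ) (k : lattice n ħ) :
    (permOp e u : lattice n ħ → ℂ) k = (u : lattice n ħ → ℂ) (e k) := rfl

lemma norm_permOp_le (e : lattice n ħ ≃ lattice n ħ) : ‖permOp e‖ ≤ 1 :=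
  LinearMap.mkContinuous_norm_le _ zero_le_one _

lemma inner_permOp (e : lattice n ħ ≃ lattice n ħ) (u v : L2 n ħ) :
    ⟪permOp e u, v⟫_ℂ = ⟪u, permOp e.symm v⟫_ℂ := by
  rw [lp.inner_eq_tsum, lp.inner_eq_tsum, ← e.symm.tsum_eq]
  simp [permOp_apply]

/-- The bounded, off-diagonal part `u ↦ ħ⁻² ∑ⱼ (u (· + ħ vⱼ) + u (· - ħ vⱼ))` of `-𝓗`. -/
def hopping : L2 n ħ →L[ℂ] L2 n ħ :=
  (((ħ ^ 2)⁻¹ : ℝ) : ℂ) •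
    ∑ j, (permOp (Equiv.addRight (step j)) + permOp (Equiv.addRight (step j)).symm)

lemma hopping_apply (u : L2 n ħ) (k : lattice n ħ) :
    (hopping u : lattice n ħ → ℂ) k = ((ħ : ℂ) ^ 2)⁻¹ *
      ∑ j, ((u : lattice n ħ → ℂ) (k + step j) + (u : lattice n ħ → ℂ) (k - step j)) := by
  simp only [hopping, smul_apply, sum_apply, lp.coeFn_smul,
    Pi.smul_apply, smul_eq_mul, lp.coeFn_sum, Finset.sum_apply, add_apply,
    lp.coeFn_add, Pi.add_apply, permOp_apply]
  push_cast
  simp [sub_eq_add_neg]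

lemma norm_hopping_le : ‖(hopping : L2 n ħ →L[ℂ] L2 n ħ)‖ ≤ (ħ ^ 2)⁻¹ * (2 * n) := by
  have h0 : (0 : ℝ) ≤ (ħ ^ 2)⁻¹ := by positivity
  rw [hopping, norm_smul, Complex.norm_real, Real.norm_of_nonneg h0]
  refine mul_le_mul_of_nonneg_left ?_ h0
  refine (norm_sum_le _ _).trans ?_
  calc ∑ j : Fin n, ‖permOp (Equiv.addRight (step (ħ := ħ) j))
        + permOp (Equiv.addRight (step j)).symm‖
      ≤ ∑ _j : Fin n, (2 : ℝ) := Finset.sum_le_sum fun j _ =>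
        (norm_add_le _ _).trans (by
          have h1 := norm_permOp_le (Equiv.addRight (step (ħ := ħ) j))
          have h2 := norm_permOp_le (Equiv.addRight (step (ħ := ħ) j)).symm
          linarith)
    _ = 2 * n := by simp [mul_comm]

lemma inner_hopping (u v : L2 n ħ) : ⟪hopping u, v⟫_ℂ = ⟪u, hopping v⟫_ℂ := by
  simp only [hopping, smul_apply, sum_apply,
    inner_smul_left, inner_smul_right, sum_inner, inner_sum, add_apply,
    inner_add_left, inner_add_right, inner_permOp, Complex.conj_ofReal, Equiv.symm_symm]
  simp [add_comm]

/-- The diagonal part `1 + 2 n ħ⁻² + V` of `I + 𝓗`. -/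
def diag (V : lattice n ħ → ℝ≥0) (k : lattice n ħ) : ℝ := 1 + (ħ ^ 2)⁻¹ * (2 * n) + V k

lemma diag_ge (V : lattice n ħ → ℝ≥0) (k : lattice n ħ) :
    1 + (ħ ^ 2)⁻¹ * (2 * n) ≤ diag V k := le_add_of_nonneg_right (V k).2

lemma diag_pos (V : lattice n ħ → ℝ≥0) (k : lattice n ħ) : 0 < diag V k :=
  lt_of_lt_of_le (by positivity) (diag_ge V k)

lemma one_add_hamiltonian_apply (V : lattice n ħ → ℝ≥0) (u : L2 n ħ) (k : lattice n ħ) :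
    (1 + hamiltonian V) (u : lattice n ħ → ℂ) k =
      (diag V k : ℂ) * (u : lattice n ħ → ℂ) k - (hopping u : lattice n ħ → ℂ) k := by
  rw [hopping_apply]
  simp only [hamiltonian, laplacian, diag, LinearMap.add_apply, Module.End.one_apply,
    LinearMap.coe_mk, AddHom.coe_mk, Pi.add_apply]
  push_cast
  ring

lemma norm_diagInv_mul_le (V : lattice n ħ → ℝ≥0) (u : L2 n ħ) (k : lattice n ħ) :
    ‖(((diag V k)⁻¹ : ℝ) : ℂ) * (u : lattice n ħ → ℂ) k‖ ≤
      ‖(((1 + (ħ ^ 2)⁻¹ * (2 * n))⁻¹ : ℝ) : ℂ) * (u : lattice n ħ → ℂ) k‖ := by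
  rw [norm_mul, norm_mul, Complex.norm_real, Complex.norm_real,
    Real.norm_of_nonneg (inv_nonneg.2 (diag_pos V k).le),
    Real.norm_of_nonneg (by positivity)]
  exact mul_le_mul_of_nonneg_right
    (inv_anti₀ (by positivity) (diag_ge V k)) (norm_nonneg _)

/-- Multiplication by the inverse of the diagonal part, as a linear map. -/
def diagInvLin (V : lattice n ħ → ℝ≥0) : L2 n ħ →ₗ[ℂ] L2 n ħ where
  toFun u := ⟨fun k => (((diag V k)⁻¹ : ℝ) : ℂ) * (u : lattice n ħ → ℂ) k,
    ((lp.memℓp u).const_mul _).mono' (norm_diagInv_mul_le V u)⟩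
  map_add' u v := by apply lp.ext; ext k; exact mul_add _ _ _
  map_smul' c u := by apply lp.ext; ext k; exact mul_left_comm _ _ _

lemma norm_diagInvLin_le (V : lattice n ħ → ℝ≥0) (u : L2 n ħ) :
    ‖diagInvLin V u‖ ≤ (1 + (ħ ^ 2)⁻¹ * (2 * n))⁻¹ * ‖u‖ := by
  have h0 : (0 : ℝ) ≤ (1 + (ħ ^ 2)⁻¹ * (2 * n))⁻¹ := by positivity
  have := lp.norm_mono (p := 2) (by norm_num) (x := diagInvLin V u)
    (y := (((1 + (ħ ^ 2)⁻¹ * (2 * n))⁻¹ : ℝ) : ℂ) • u) (norm_diagInv_mul_le V u)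
  refine this.trans (le_of_eq ?_)
  rw [norm_smul, Complex.norm_real, Real.norm_of_nonneg h0]

/-- Multiplication by the inverse of the diagonal part, as a bounded operator. -/
def diagInv (V : lattice n ħ → ℝ≥0) : L2 n ħ →L[ℂ] L2 n ħ :=
  LinearMap.mkContinuous (diagInvLin V) (1 + (ħ ^ 2)⁻¹ * (2 * n))⁻¹ (norm_diagInvLin_le V)

lemma diagInv_apply (V : lattice n ħ → ℝ≥0) (u : L2 n ħ) (k : lattice n ħ) :
    (diagInv V u : lattice n ħ → ℂ) k = (((diag V k)⁻¹ : ℝ) : ℂ) * (u : lattice n ħ → ℂ) k := rfl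

lemma norm_diagInv_hopping_lt (V : lattice n ħ → ℝ≥0) : ‖(diagInv V * hopping : L2 n ħ →L[ℂ] L2 n ħ)‖ < 1 := by
  have h0 : (0 : ℝ) ≤ (ħ ^ 2)⁻¹ * (2 * n) := by positivity
  have h1 : ‖diagInv V‖ ≤ (1 + (ħ ^ 2)⁻¹ * (2 * n))⁻¹ :=
    LinearMap.mkContinuous_norm_le _ (by positivity) _
  calc ‖(diagInv V * hopping : L2 n ħ →L[ℂ] L2 n ħ)‖ ≤ ‖diagInv V‖ * ‖(hopping : L2 n ħ →L[ℂ] L2 n ħ)‖ := norm_mul_le _ _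
    _ ≤ (1 + (ħ ^ 2)⁻¹ * (2 * n))⁻¹ * ((ħ ^ 2)⁻¹ * (2 * n)) := by
        gcongr
        exact norm_hopping_le
    _ < 1 := by
        rw [inv_mul_lt_one₀ (by positivity)]; linarith

lemma one_add_hamiltonian_eq_iff (V : lattice n ħ → ℝ≥0) (v g : L2 n ħ) :
    (1 + hamiltonian V) (v : lattice n ħ → ℂ) = (g : lattice n ħ → ℂ) ↔
      (1 - diagInv V * hopping : L2 n ħ →L[ℂ] L2 n ħ) v = diagInv V g := by
  have key : ∀ k, (diag V k : ℂ) ≠ 0 := fun k => by exact_mod_cast (diag_pos V k).ne'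
  rw [sub_apply, one_apply_eq_self, mul_apply_eq_comp]
  constructor
  · intro h
    apply lp.ext; ext k
    have hk := congrFun h k
    rw [one_add_hamiltonian_apply] at hk
    rw [lp.coeFn_sub, Pi.sub_apply, diagInv_apply, diagInv_apply, ← hk]
    push_cast
    field_simp [key k]
  · intro h
    ext k
    have hk : (v - diagInv V (hopping v) : L2 n ħ).1 k = (diagInv V g).1 k := by rw [h]
    rw [lp.coeFn_sub, Pi.sub_apply, diagInv_apply, diagInv_apply] at hk
    rw [one_add_hamiltonian_apply]
    push_cast at hk
    field_simp [key k] at hk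
    linear_combination hk

/-- `I + 𝓗` is boundedly invertible in `ℓ²(ħℤⁿ)`. -/
theorem exists_resolvent (V : lattice n ħ → ℝ≥0) : ∃ G : L2 n ħ →L[ℂ] L2 n ħ,
    ∀ v g : L2 n ħ, G g = v ↔ (1 + hamiltonian V) (v : lattice n ħ → ℂ) = g := by
  obtain ⟨U, hU⟩ := isUnit_one_sub_of_norm_lt_one (norm_diagInv_hopping_lt V)
  refine ⟨(↑U⁻¹ : L2 n ħ →L[ℂ] L2 n ħ) * diagInv V, fun v g => ?_⟩
  rw [one_add_hamiltonian_eq_iff, ← hU, mul_apply_eq_comp]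
  constructor
  · rintro rfl
    rw [← mul_apply_eq_comp, Units.mul_inv, one_apply_eq_self]
  · intro h
    rw [← h, ← mul_apply_eq_comp, Units.inv_mul, one_apply_eq_self]

/-- The resolvent `(I + 𝓗)⁻¹`: `resolvent V g` is the unique `v ∈ ℓ²` with `(I + 𝓗) v = g`. -/
def resolvent (V : lattice n ħ → ℝ≥0) : L2 n ħ →L[ℂ] L2 n ħ := (exists_resolvent V).choose

lemma resolvent_eq_iff (V : lattice n ħ → ℝ≥0) (v g : L2 n ħ) :
    resolvent V g = v ↔ (1 + hamiltonian V) (v : lattice n ħ → ℂ) = g :=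
  (exists_resolvent V).choose_spec v g

lemma one_add_resolvent (V : lattice n ħ → ℝ≥0) (g : L2 n ħ) :
    (1 + hamiltonian V) (resolvent V g : lattice n ħ → ℂ) = g :=
  (resolvent_eq_iff V _ g).1 rfl

lemma inner_diag (V : lattice n ħ → ℝ≥0) (g h : L2 n ħ) :
    ⟪resolvent V g, h + hopping (resolvent V h)⟫_ℂ =
      ⟪g + hopping (resolvent V g), resolvent V h⟫_ℂ := by
  rw [lp.inner_eq_tsum, lp.inner_eq_tsum]
  refine tsum_congr fun k => ?_
  have hg := congrFun (one_add_resolvent V g) k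
  have hh := congrFun (one_add_resolvent V h) k
  rw [one_add_hamiltonian_apply] at hg hh
  rw [lp.coeFn_add, lp.coeFn_add, Pi.add_apply, Pi.add_apply, ← hg, ← hh]
  simp only [RCLike.inner_apply, sub_add_cancel, map_mul, Complex.conj_ofReal]
  ring

lemma resolvent_symm (V : lattice n ħ → ℝ≥0) (g h : L2 n ħ) :
    ⟪resolvent V g, h⟫_ℂ = ⟪g, resolvent V h⟫_ℂ := by
  have := inner_diag V g h
  rw [inner_add_left, inner_add_right, inner_hopping] at this
  exact add_right_cancel this

lemma resolvent_nonneg (V : lattice n ħ → ℝ≥0) : 0 ≤ resolvent V := by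
  rw [ContinuousLinearMap.nonneg_iff_isPositive, ContinuousLinearMap.isPositive_def]
  refine ⟨fun g h => resolvent_symm V g h, fun g => ?_⟩
  set v := resolvent V g with hv
  have h1 : ⟪v, g⟫_ℂ = ⟪v, g + hopping v⟫_ℂ - ⟪v, hopping v⟫_ℂ := by
    rw [inner_add_right, add_sub_cancel_right]
  have h2 : ‖⟪v, hopping v⟫_ℂ‖ ≤ (ħ ^ 2)⁻¹ * (2 * n) * ‖v‖ ^ 2 := by
    refine (norm_inner_le_norm _ _).trans ?_
    have := hopping.le_of_opNorm_le (norm_hopping_le (n := n) (ħ := ħ)) v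
    nlinarith [norm_nonneg v]
  have h3 : (1 + (ħ ^ 2)⁻¹ * (2 * n)) * ‖v‖ ^ 2 ≤ (⟪v, g + hopping v⟫_ℂ).re := by
    have e1 := Complex.hasSum_re (lp.hasSum_inner v v)
    have e2 := Complex.hasSum_re (lp.hasSum_inner v (g + hopping v))
    have e3 : (⟪v, v⟫_ℂ).re = ‖v‖ ^ 2 := by
      exact (norm_sq_eq_re_inner (𝕜 := ℂ) v).symm
    rw [e3] at e1
    refine hasSum_le (fun k => ?_) (e1.mul_left _) e2
    have hk := congrFun (one_add_resolvent V g) k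
    rw [one_add_hamiltonian_apply] at hk
    rw [lp.coeFn_add, Pi.add_apply, ← hk]
    simp only [RCLike.inner_apply, sub_add_cancel, ← hv]
    rw [mul_assoc, Complex.mul_conj, ← Complex.ofReal_mul, Complex.ofReal_re, Complex.ofReal_re]
    exact mul_le_mul_of_nonneg_right (diag_ge V k) (Complex.normSq_nonneg _)
  have h4 : (⟪v, hopping v⟫_ℂ).re ≤ ‖⟪v, hopping v⟫_ℂ‖ := Complex.re_le_norm _
  rw [ContinuousLinearMap.reApplyInnerSelf_apply]
  change 0 ≤ (⟪v, g⟫_ℂ).re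
  rw [h1, Complex.sub_re]
  nlinarith [sq_nonneg ‖v‖]

/-! ### Test functions and real powers of `I + 𝓗` -/

/-- The space `H^∞ = ⋂ₖ Dom 𝓗ᵏ` of test functions: all `φ ∈ ℓ²` with `(I + 𝓗)ʲ φ ∈ ℓ²` for
every `j`. -/
def testSpace (V : lattice n ħ → ℝ≥0) : Submodule ℂ (L2 n ħ) where
  carrier := {φ | ∀ j : ℕ, Memℓp (((1 + hamiltonian V) ^ j) (φ : lattice n ħ → ℂ)) 2}
  zero_mem' j := by
    rw [lp.coeFn_zero, map_zero]; exact zero_memℓp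
  add_mem' {φ ψ} hφ hψ j := by
    rw [lp.coeFn_add, map_add]; exact (hφ j).add (hψ j)
  smul_mem' c φ hφ j := by
    rw [lp.coeFn_smul, map_smul]; exact (hφ j).const_smul c

/-- The map `φ ↦ (I + 𝓗)ʲ φ ∈ ℓ²` on test functions. -/
def powTest (V : lattice n ħ → ℝ≥0) (j : ℕ) : testSpace V →ₗ[ℂ] L2 n ħ where
  toFun φ := ⟨((1 + hamiltonian V) ^ j) ((φ : L2 n ħ) : lattice n ħ → ℂ), φ.2 j⟩
  map_add' φ ψ := by
    apply lp.ext
    change ((1 + hamiltonian V) ^ j) (((φ : L2 n ħ) : lattice n ħ → ℂ) + (ψ : L2 n ħ)) = _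
    rw [map_add]; rfl
  map_smul' c φ := by
    apply lp.ext
    change ((1 + hamiltonian V) ^ j) (c • ((φ : L2 n ħ) : lattice n ħ → ℂ)) = _
    rw [map_smul]; rfl

lemma powTest_zero (V : lattice n ħ → ℝ≥0) (φ : testSpace V) : powTest V 0 φ = φ := by
  apply lp.ext
  change ((1 + hamiltonian V) ^ (0 : ℕ)) ((φ : L2 n ħ) : lattice n ħ → ℂ) = ((φ : L2 n ħ) : lattice n ħ → ℂ)
  rw [pow_zero]; rfl

lemma resolvent_powTest_succ (V : lattice n ħ → ℝ≥0) (j : ℕ) (φ : testSpace V) :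
    resolvent V (powTest V (j + 1) φ) = powTest V j φ := by
  rw [resolvent_eq_iff]
  change _ = ((1 + hamiltonian V) ^ (j + 1)) ((φ : L2 n ħ) : lattice n ħ → ℂ)
  rw [pow_succ']; rfl

lemma resolvent_pow_powTest (V : lattice n ħ → ℝ≥0) (m j : ℕ) (φ : testSpace V) :
    (resolvent V ^ m) (powTest V (m + j) φ) = powTest V j φ := by
  induction m with
  | zero => rw [pow_zero, zero_add]; rfl
  | succ m ih =>
    rw [pow_succ, mul_apply_eq_comp, show m + 1 + j = (m + j) + 1 by ring,
      resolvent_powTest_succ, ih]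

lemma one_add_pow_resolvent_pow (V : lattice n ħ → ℝ≥0) (j : ℕ) (g : L2 n ħ) :
    ((1 + hamiltonian V) ^ j) ((resolvent V ^ j) g : lattice n ħ → ℂ) = g := by
  induction j with
  | zero => rfl
  | succ j ih =>
    rw [pow_succ (1 + hamiltonian V), pow_succ' (resolvent V), Module.End.mul_apply,
      mul_apply_eq_comp, one_add_resolvent, ih]

lemma resolvent_pow_injective (V : lattice n ħ → ℝ≥0) (j : ℕ) :
    Function.Injective (resolvent V ^ j : L2 n ħ →L[ℂ] L2 n ħ) := fun g h hgh => by
  apply lp.ext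
  rw [← one_add_pow_resolvent_pow V j g, hgh, one_add_pow_resolvent_pow]

lemma mem_testSpace_iff (V : lattice n ħ → ℝ≥0) (φ : L2 n ħ) :
    φ ∈ testSpace V ↔ ∀ j : ℕ, ∃ g, (resolvent V ^ j : L2 n ħ →L[ℂ] L2 n ħ) g = φ := by
  constructor
  · intro h j
    exact ⟨powTest V (j + 0) ⟨φ, h⟩, by rw [resolvent_pow_powTest, powTest_zero]⟩
  · intro h j
    obtain ⟨g, rfl⟩ := h j
    rw [one_add_pow_resolvent_pow]; exact lp.memℓp g

lemma powTest_eq_iff (V : lattice n ħ → ℝ≥0) (j : ℕ) (φ : testSpace V) (g : L2 n ħ) :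
    powTest V j φ = g ↔ (resolvent V ^ j) g = φ := by
  have h : (resolvent V ^ j) (powTest V j φ) = φ := by
    have := resolvent_pow_powTest V j 0 φ
    rwa [add_zero, powTest_zero] at this
  constructor
  · rintro rfl; exact h
  · intro hg; exact resolvent_pow_injective V j (h.trans hg.symm)

section Power

variable {E : Type*} [NormedAddCommGroup E] [InnerProductSpace ℂ E] [CompleteSpace E]

/-- The real power `A^α` of a non-negative bounded operator, by the continuous functional
calculus. -/
def opPow (A : E →L[ℂ] E) (α : ℝ) : E →L[ℂ] E := CFC.rpow A α

lemma opPow_natCast {A : E →L[ℂ] E} (hA : 0 ≤ A) (j : ℕ) : opPow A j = A ^ j :=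
  CFC.rpow_natCast A j hA

lemma opPow_zero {A : E →L[ℂ] E} (hA : 0 ≤ A) : opPow A 0 = 1 := CFC.rpow_zero A hA

lemma opPow_add {A : E →L[ℂ] E} (hA : 0 ≤ A) {α β : ℝ} (hα : 0 ≤ α) (hβ : 0 ≤ β) :
    opPow A (α + β) = opPow A α * opPow A β := by
  rcases hα.eq_or_lt with rfl | hα
  · rw [zero_add, opPow_zero hA, one_mul]
  rcases hβ.eq_or_lt with rfl | hβ
  · rw [add_zero, opPow_zero hA, mul_one]
  have key : ∀ γ : ℝ≥0, 0 < γ → opPow A γ = A ^ γ := fun γ hγ => (CFC.nnrpow_eq_rpow hγ).symm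
  lift α to ℝ≥0 using hα.le
  lift β to ℝ≥0 using hβ.le
  norm_cast at hα hβ
  rw [← NNReal.coe_add, key _ (add_pos hα hβ), key _ hα, key _ hβ, CFC.nnrpow_add hα hβ]

lemma opPow_nonneg (A : E →L[ℂ] E) (α : ℝ) : 0 ≤ opPow A α := cfc_predicate _ A

end Power

/-- The bounded operator `(I + 𝓗)^(-α)`, `α ≥ 0`: the `α`-th power of the non-negative operator
`(I + 𝓗)⁻¹`. -/
def negPow (V : lattice n ħ → ℝ≥0) (α : ℝ) : L2 n ħ →L[ℂ] L2 n ħ := opPow (resolvent V) α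

lemma negPow_zero (V : lattice n ħ → ℝ≥0) : negPow V 0 = 1 := opPow_zero (resolvent_nonneg V)

lemma negPow_natCast (V : lattice n ħ → ℝ≥0) (j : ℕ) : negPow V j = resolvent V ^ j :=
  opPow_natCast (resolvent_nonneg V) j

lemma negPow_add (V : lattice n ħ → ℝ≥0) {α β : ℝ} (hα : 0 ≤ α) (hβ : 0 ≤ β) :
    negPow V (α + β) = negPow V α * negPow V β := opPow_add (resolvent_nonneg V) hα hβ

lemma inner_negPow (V : lattice n ħ → ℝ≥0) (α : ℝ) (g h : L2 n ħ) :
    ⟪negPow V α g, h⟫_ℂ = ⟪g, negPow V α h⟫_ℂ := by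
  have h0 : 0 ≤ negPow V α := opPow_nonneg _ _
  rw [ContinuousLinearMap.nonneg_iff_isPositive] at h0
  exact h0.isSymmetric g h

lemma resolvent_pow_negPow (V : lattice n ħ → ℝ≥0) (j : ℕ) {α : ℝ} (hα : 0 ≤ α) (g : L2 n ħ) :
    (resolvent V ^ j) (negPow V α g) = negPow V α ((resolvent V ^ j) g) := by
  rw [← mul_apply_eq_comp, ← mul_apply_eq_comp, ← negPow_natCast, ← negPow_add V (by positivity) hα,
    ← negPow_add V hα (by positivity), add_comm]

lemma ceil_sub_nonneg (r : ℝ) : 0 ≤ (⌈r⌉₊ : ℝ) - r := sub_nonneg.2 (Nat.le_ceil r)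

lemma realPow_mem (V : lattice n ħ → ℝ≥0) (r : ℝ) (φ : testSpace V) :
    negPow V (⌈r⌉₊ - r) (powTest V ⌈r⌉₊ φ) ∈ testSpace V := by
  rw [mem_testSpace_iff]
  intro j
  exact ⟨negPow V (⌈r⌉₊ - r) (powTest V (j + ⌈r⌉₊) φ), by
    rw [resolvent_pow_negPow V j (ceil_sub_nonneg r), resolvent_pow_powTest]⟩

/-- The real power `(I + 𝓗)^r : H^∞ → H^∞`, `r ∈ ℝ`, computed as `(I + 𝓗)^(-(N - r)) (I + 𝓗)^N`
with `N = max ⌈r⌉ 0`. -/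
def realPow (V : lattice n ħ → ℝ≥0) (r : ℝ) : testSpace V →ₗ[ℂ] testSpace V where
  toFun φ := ⟨negPow V (⌈r⌉₊ - r) (powTest V ⌈r⌉₊ φ), realPow_mem V r φ⟩
  map_add' φ ψ := by ext1; simp
  map_smul' c φ := by ext1; simp

lemma resolvent_pow_realPow (V : lattice n ħ → ℝ≥0) {r : ℝ} {m : ℕ} (h : r ≤ m)
    (φ : testSpace V) : (resolvent V ^ m) (realPow V r φ : L2 n ħ) = negPow V (m - r) φ := by
  obtain ⟨l, rfl⟩ := Nat.exists_eq_add_of_le (Nat.ceil_le.2 h)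
  change (resolvent V ^ (⌈r⌉₊ + l)) (negPow V (⌈r⌉₊ - r) (powTest V ⌈r⌉₊ φ)) = _
  have h1 : (resolvent V ^ ⌈r⌉₊) (powTest V ⌈r⌉₊ φ) = φ := (powTest_eq_iff V _ φ _).1 rfl
  rw [resolvent_pow_negPow V _ (ceil_sub_nonneg r), add_comm, pow_add, mul_apply_eq_comp, h1,
    ← negPow_natCast, ← mul_apply_eq_comp, ← negPow_add V (ceil_sub_nonneg r) (by positivity)]
  congr 2
  push_cast; ring

/-- The group law `(I + 𝓗)^r (I + 𝓗)^t = (I + 𝓗)^(r + t)`. -/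
lemma realPow_realPow (V : lattice n ħ → ℝ≥0) (r t : ℝ) (φ : testSpace V) :
    realPow V r (realPow V t φ) = realPow V (r + t) φ := by
  ext1
  apply resolvent_pow_injective V (⌈t⌉₊ + ⌈r⌉₊)
  rw [resolvent_pow_realPow V (r := r + t) (by push_cast; linarith [Nat.le_ceil r, Nat.le_ceil t]),
    pow_add, mul_apply_eq_comp, resolvent_pow_realPow V (Nat.le_ceil r),
    resolvent_pow_negPow V _ (ceil_sub_nonneg r), resolvent_pow_realPow V (Nat.le_ceil t),
    ← mul_apply_eq_comp, ← negPow_add V (ceil_sub_nonneg r) (ceil_sub_nonneg t)]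
  congr 2
  push_cast; ring

lemma realPow_zero (V : lattice n ħ → ℝ≥0) (φ : testSpace V) : realPow V 0 φ = φ := by
  ext1
  have h := resolvent_pow_realPow V (r := 0) (m := 0) (by simp) φ
  rw [Nat.cast_zero, sub_zero, negPow_zero] at h
  exact h

/-- The operator `𝓗 : H^∞ → H^∞`. -/
def hamiltonianTest (V : lattice n ħ → ℝ≥0) : testSpace V →ₗ[ℂ] testSpace V where
  toFun φ := ⟨⟨hamiltonian V ((φ : L2 n ħ) : lattice n ħ → ℂ), by
      have : hamiltonian V ((φ : L2 n ħ) : lattice n ħ → ℂ) = (powTest V 1 φ - φ : L2 n ħ) := by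
        rw [lp.coeFn_sub]
        change hamiltonian V ((φ : L2 n ħ) : lattice n ħ → ℂ) =
          ((1 + hamiltonian V) ^ (1 : ℕ)) ((φ : L2 n ħ) : lattice n ħ → ℂ) - _
        rw [pow_one, LinearMap.add_apply, Module.End.one_apply, add_sub_cancel_left]
      rw [this]; exact lp.memℓp _⟩, by
    intro j
    have : ((1 + hamiltonian V) ^ j) (hamiltonian V ((φ : L2 n ħ) : lattice n ħ → ℂ)) =
        (powTest V (j + 1) φ - powTest V j φ : L2 n ħ) := by
      rw [lp.coeFn_sub]
      change _ = ((1 + hamiltonian V) ^ (j + 1)) ((φ : L2 n ħ) : lattice n ħ → ℂ)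
        - ((1 + hamiltonian V) ^ j) ((φ : L2 n ħ) : lattice n ħ → ℂ)
      rw [pow_succ, Module.End.mul_apply, LinearMap.add_apply, Module.End.one_apply, map_add,
        add_sub_cancel_left]
    change Memℓp (((1 + hamiltonian V) ^ j) (hamiltonian V _)) 2
    rw [this]; exact lp.memℓp _⟩
  map_add' φ ψ := by
    ext1; apply lp.ext; exact map_add (hamiltonian V) _ _
  map_smul' c φ := by
    ext1; apply lp.ext; exact map_smul (hamiltonian V) c _

lemma powTest_hamiltonianTest (V : lattice n ħ → ℝ≥0) (j : ℕ) (φ : testSpace V) :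
    powTest V j (hamiltonianTest V φ) = powTest V (j + 1) φ - powTest V j φ := by
  apply lp.ext
  rw [lp.coeFn_sub]
  change ((1 + hamiltonian V) ^ j) (hamiltonian V ((φ : L2 n ħ) : lattice n ħ → ℂ)) =
    ((1 + hamiltonian V) ^ (j + 1)) ((φ : L2 n ħ) : lattice n ħ → ℂ)
      - ((1 + hamiltonian V) ^ j) ((φ : L2 n ħ) : lattice n ħ → ℂ)
  rw [pow_succ, Module.End.mul_apply, LinearMap.add_apply, Module.End.one_apply, map_add,
    add_sub_cancel_left]

lemma powTest_realPow (V : lattice n ħ → ℝ≥0) (j : ℕ) (r : ℝ) (φ : testSpace V) :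
    powTest V j (realPow V r φ) = negPow V (⌈r⌉₊ - r) (powTest V (j + ⌈r⌉₊) φ) := by
  rw [powTest_eq_iff, resolvent_pow_negPow V j (ceil_sub_nonneg r), resolvent_pow_powTest]
  rfl

lemma finite_support_one_add_hamiltonian (V : lattice n ħ → ℝ≥0) (u : lattice n ħ → ℂ)
    (hu : (Function.support u).Finite) :
    (Function.support ((1 + hamiltonian V) u)).Finite := by
  refine (hu.union (Set.finite_iUnion fun j : Fin n =>
    (hu.preimage (f := fun k => k + step j) (add_left_injective _).injOn).union
      (hu.preimage (f := fun k => k - step j) (sub_left_injective).injOn))).subset ?_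
  intro k hk
  by_contra hn
  simp only [mem_union, mem_iUnion, mem_preimage, Function.mem_support, not_or, not_exists,
    not_not] at hn
  apply hk
  simp [hamiltonian, laplacian, hn.1, (hn.2 _).1, (hn.2 _).2]

lemma single_mem_testSpace [DecidableEq (lattice n ħ)] (V : lattice n ħ → ℝ≥0)
    (k : lattice n ħ) : (lp.single 2 k (1 : ℂ) : L2 n ħ) ∈ testSpace V := by
  intro j
  refine (memℓp_zero ?_).of_exponent_ge zero_le
  change (Function.support _).Finite
  induction j with
  | zero =>
    refine (Set.finite_singleton k).subset fun l hl => ?_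
    by_contra hne
    exact hl (lp.single_apply_ne (E := fun _ : lattice n ħ => ℂ) 2 k (1 : ℂ) hne)
  | succ j ih =>
    rw [pow_succ', Module.End.mul_apply]
    exact finite_support_one_add_hamiltonian V _ ih

/-! ### Distributions and Sobolev spaces -/

/-- The norms `max_{j ≤ k} ‖(I + 𝓗)ʲ φ‖` that define the Fréchet topology of `H^∞`. -/
def testNorm (V : lattice n ħ → ℝ≥0) (k : ℕ) (φ : testSpace V) : ℝ :=
  ⨆ j : Fin (k + 1), ‖powTest V j φ‖

lemma le_testNorm (V : lattice n ħ → ℝ≥0) {j k : ℕ} (h : j ≤ k) (φ : testSpace V) :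
    ‖powTest V j φ‖ ≤ testNorm V k φ :=
  le_ciSup (f := fun i : Fin (k + 1) => ‖powTest V i φ‖) (Set.finite_range _).bddAbove
    ⟨j, Nat.lt_succ_of_le h⟩

lemma testNorm_le (V : lattice n ħ → ℝ≥0) {k : ℕ} (φ : testSpace V) {C : ℝ}
    (h : ∀ j ≤ k, ‖powTest V j φ‖ ≤ C) : testNorm V k φ ≤ C :=
  ciSup_le fun j => h j (Nat.lt_succ_iff.1 j.2)

lemma testNorm_nonneg (V : lattice n ħ → ℝ≥0) (k : ℕ) (φ : testSpace V) : 0 ≤ testNorm V k φ :=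
  (norm_nonneg _).trans (le_testNorm V zero_le φ)

lemma testNorm_mono (V : lattice n ħ → ℝ≥0) {k l : ℕ} (h : k ≤ l) (φ : testSpace V) :
    testNorm V k φ ≤ testNorm V l φ :=
  testNorm_le V φ fun _ hj => le_testNorm V (hj.trans h) φ

/-- The space `H^{-∞}` of `𝓗`-distributions: the continuous functionals on `H^∞`. As the pairing
is `(w, φ) = ∑ₖ w (k) conj (φ (k))`, they are conjugate-linear. -/
def distribution (V : lattice n ħ → ℝ≥0) : Submodule ℂ (testSpace V →ₗ⋆[ℂ] ℂ) where
  carrier := {w | ∃ (k : ℕ) (C : ℝ), ∀ φ, ‖w φ‖ ≤ C * testNorm V k φ}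
  zero_mem' := ⟨0, 0, fun φ => by simp⟩
  add_mem' := by
    rintro w w' ⟨k, C, h⟩ ⟨k', C', h'⟩
    refine ⟨max k k', |C| + |C'|, fun φ => ?_⟩
    have h1 := testNorm_mono V (le_max_left k k') φ
    have h2 := testNorm_mono V (le_max_right k k') φ
    have h3 := testNorm_nonneg V k φ
    have h4 := testNorm_nonneg V k' φ
    calc ‖w φ + w' φ‖ ≤ ‖w φ‖ + ‖w' φ‖ := norm_add_le _ _
      _ ≤ |C| * testNorm V k φ + |C'| * testNorm V k' φ :=
        add_le_add ((h φ).trans (mul_le_mul_of_nonneg_right (le_abs_self _) h3))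
          ((h' φ).trans (mul_le_mul_of_nonneg_right (le_abs_self _) h4))
      _ ≤ (|C| + |C'|) * testNorm V (max k k') φ := by
        rw [add_mul]; gcongr
  smul_mem' := by
    rintro c w ⟨k, C, h⟩
    refine ⟨k, ‖c‖ * C, fun φ => ?_⟩
    rw [LinearMap.smul_apply, norm_smul, mul_assoc]
    exact mul_le_mul_of_nonneg_left (h φ) (norm_nonneg c)

/-- The value `(w, φ)` of a distribution at a test function. -/
def pairing {V : lattice n ħ → ℝ≥0} (w : distribution V) (φ : testSpace V) : ℂ := w.1 φ

/-- The embedding `ℓ² → H^{-∞}`, `(g, φ) = ∑ₖ g (k) conj (φ (k))`. -/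
def ofL2 (V : lattice n ħ → ℝ≥0) : L2 n ħ →ₗ[ℂ] distribution V where
  toFun g := ⟨{ toFun := fun φ => ⟪(φ : L2 n ħ), g⟫_ℂ
                map_add' := fun φ ψ => inner_add_left (φ : L2 n ħ) (ψ : L2 n ħ) g
                map_smul' := fun c φ => inner_smul_left (φ : L2 n ħ) g c }, 0, ‖g‖, fun φ => by
    have h := le_testNorm V le_rfl (j := 0) φ
    rw [powTest_zero] at h
    change ‖⟪(φ : L2 n ħ), g⟫_ℂ‖ ≤ _
    refine (norm_inner_le_norm _ _).trans ?_
    rw [mul_comm]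
    exact mul_le_mul_of_nonneg_left h (norm_nonneg g)⟩
  map_add' g h := by
    ext φ; exact inner_add_right (φ : L2 n ħ) g h
  map_smul' c g := by
    ext φ; exact inner_smul_right (φ : L2 n ħ) g c

lemma ofL2_injective (V : lattice n ħ → ℝ≥0) : Function.Injective (ofL2 V) := by
  classical
  rw [injective_iff_map_eq_zero]
  intro g hg
  apply lp.ext; ext k
  have h : pairing (ofL2 V g) ⟨_, single_mem_testSpace V k⟩ = 0 := by rw [hg]; rfl
  change ⟪(lp.single 2 k (1 : ℂ) : L2 n ħ), g⟫_ℂ = 0 at h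
  rw [lp.inner_single_left] at h
  simpa using h

/-- Extension of a symmetric operator on test functions to distributions by duality,
`(B w, φ) = (w, B φ)`. -/
def dual {V : lattice n ħ → ℝ≥0} (B : testSpace V →ₗ[ℂ] testSpace V)
    (hB : ∀ j : ℕ, ∃ (m : ℕ) (C : ℝ), ∀ φ, ‖powTest V j (B φ)‖ ≤ C * testNorm V m φ) :
    distribution V →ₗ[ℂ] distribution V where
  toFun w := ⟨w.1.comp B, by
    obtain ⟨k, C, hw⟩ := w.2
    choose m D h using hB
    refine ⟨(Finset.range (k + 1)).sup m, |C| * ∑ j ∈ Finset.range (k + 1), |D j|, fun φ => ?_⟩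
    refine (hw (B φ)).trans ?_
    refine (mul_le_mul_of_nonneg_right (le_abs_self C) (testNorm_nonneg V k _)).trans ?_
    rw [mul_assoc]
    refine mul_le_mul_of_nonneg_left ?_ (abs_nonneg C)
    refine testNorm_le V _ fun j hj => (h j φ).trans ?_
    have hj' : j ∈ Finset.range (k + 1) := Finset.mem_range.2 (Nat.lt_succ_of_le hj)
    exact mul_le_mul ((le_abs_self _).trans
      (Finset.single_le_sum (f := fun j => |D j|) (fun i _ => abs_nonneg _) hj'))
      (testNorm_mono V (Finset.le_sup hj') φ) (testNorm_nonneg V _ φ)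
      (Finset.sum_nonneg fun i _ => abs_nonneg _)⟩
  map_add' _ _ := rfl
  map_smul' _ _ := rfl

/-- The operator `𝓗` on distributions. -/
def hamiltonianDist (V : lattice n ħ → ℝ≥0) : distribution V →ₗ[ℂ] distribution V :=
  dual (hamiltonianTest V) fun j => ⟨j + 1, 2, fun φ => by
    rw [powTest_hamiltonianTest]
    refine (norm_sub_le _ _).trans ?_
    linarith [le_testNorm V (le_refl (j + 1)) φ, le_testNorm V (Nat.le_succ j) φ]⟩

/-- The real power `(I + 𝓗)^r` on distributions. -/
def realPowDist (V : lattice n ħ → ℝ≥0) (r : ℝ) : distribution V →ₗ[ℂ] distribution V :=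
  dual (realPow V r) fun j => ⟨j + ⌈r⌉₊, ‖negPow V (⌈r⌉₊ - r)‖, fun φ => by
    rw [powTest_realPow]
    exact ((negPow V _).le_opNorm _).trans
      (mul_le_mul_of_nonneg_left (le_testNorm V le_rfl φ) (norm_nonneg _))⟩

lemma realPowDist_injective (V : lattice n ħ → ℝ≥0) (r : ℝ) :
    Function.Injective (realPowDist V r) := by
  rw [injective_iff_map_eq_zero]
  intro w hw
  ext φ
  have h : pairing (realPowDist V r w) (realPow V (-r) φ) = 0 := by rw [hw]; rfl
  change w.1 (realPow V r (realPow V (-r) φ)) = 0 at h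
  rw [realPow_realPow, add_neg_cancel, realPow_zero] at h
  exact h

/-- The Sobolev space `H^s = {w ∈ H^{-∞} : (I + 𝓗)^(s/2) w ∈ ℓ²}`. -/
def sobolev (V : lattice n ħ → ℝ≥0) (s : ℝ) : Submodule ℂ (distribution V) :=
  (LinearMap.range (ofL2 V)).comap (realPowDist V (s / 2))

/-- The map `w ↦ (I + 𝓗)^(s/2) w` from `H^s` to `ℓ²`. -/
def sobolevToL2 (V : lattice n ħ → ℝ≥0) (s : ℝ) : sobolev V s →ₗ[ℂ] L2 n ħ :=
  (LinearEquiv.ofInjective (ofL2 V) (ofL2_injective V)).symm.toLinearMap ∘ₗ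
    ((realPowDist V (s / 2)).domRestrict (sobolev V s)).codRestrict
      (LinearMap.range (ofL2 V)) fun w => w.2

lemma ofL2_sobolevToL2 (V : lattice n ħ → ℝ≥0) (s : ℝ) (w : sobolev V s) :
    ofL2 V (sobolevToL2 V s w) = realPowDist V (s / 2) w := by
  have := LinearEquiv.apply_symm_apply (LinearEquiv.ofInjective (ofL2 V) (ofL2_injective V))
    (((realPowDist V (s / 2)).domRestrict (sobolev V s)).codRestrict
      (LinearMap.range (ofL2 V)) (fun w => w.2) w)
  exact congrArg Subtype.val this

lemma sobolevToL2_injective (V : lattice n ħ → ℝ≥0) (s : ℝ) :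
    Function.Injective (sobolevToL2 V s) := fun w w' h => by
  apply Subtype.ext
  apply realPowDist_injective V (s / 2)
  rw [← ofL2_sobolevToL2, ← ofL2_sobolevToL2, h]

/-- The norm `‖w‖_{H^s} = ‖(I + 𝓗)^(s/2) w‖_{ℓ²}`. -/
instance (V : lattice n ħ → ℝ≥0) (s : ℝ) : NormedAddCommGroup (sobolev V s) :=
  NormedAddCommGroup.induced _ _ (sobolevToL2 V s) (sobolevToL2_injective V s)

instance (V : lattice n ħ → ℝ≥0) (s : ℝ) : NormedSpace ℂ (sobolev V s) :=
  NormedSpace.induced ℂ _ _ (sobolevToL2 V s)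

lemma norm_sobolev (V : lattice n ħ → ℝ≥0) (s : ℝ) (w : sobolev V s) :
    ‖w‖ = ‖sobolevToL2 V s w‖ := rfl

lemma sobolev_one_add_le (V : lattice n ħ → ℝ≥0) (s : ℝ) : sobolev V (1 + s) ≤ sobolev V s := by
  rintro w ⟨g, hg⟩
  refine ⟨negPow V (1 / 2) g, ?_⟩
  ext φ
  have h : pairing (ofL2 V g) (realPow V (-(1 / 2)) φ) =
      pairing (realPowDist V ((1 + s) / 2) w) (realPow V (-(1 / 2)) φ) := by rw [hg]
  change ⟪(realPow V (-(1 / 2)) φ : L2 n ħ), g⟫_ℂ =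
    w.1 (realPow V ((1 + s) / 2) (realPow V (-(1 / 2)) φ)) at h
  change ⟪(φ : L2 n ħ), negPow V (1 / 2) g⟫_ℂ = w.1 (realPow V (s / 2) φ)
  have h1 : (realPow V (-(1 / 2)) φ : L2 n ħ) = negPow V (1 / 2) φ := by
    have := resolvent_pow_realPow V (r := -(1 / 2)) (m := 0) (by norm_num) φ
    rw [Nat.cast_zero, zero_sub, neg_neg] at this
    exact this
  rw [realPow_realPow, h1, inner_negPow, show (1 + s) / 2 + -(1 / 2) = s / 2 by ring] at h
  exact h

/-- The inclusion `H^{1+s} ⊆ H^s`. -/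
def sobolevIncl (V : lattice n ħ → ℝ≥0) (s : ℝ) : sobolev V (1 + s) →ₗ[ℂ] sobolev V s :=
  Submodule.inclusion (sobolev_one_add_le V s)

/-! ### The Cauchy problem -/

/-- Lebesgue measure on `[0, T]`. -/
def timeMeasure (T : ℝ) : Measure ℝ := volume.restrict (Icc 0 T)

/-- `a ∈ L^∞_1([0, T])`: `a` is absolutely continuous on `[0, T]`, and `a` and its derivative
(which exists almost everywhere) belong to `L^∞([0, T])`. In particular this holds if `a` is
differentiable everywhere with bounded derivative. -/
structure MemLInftyOne (T : ℝ) (a : ℝ → ℝ) : Prop where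
  absolutelyContinuous : AbsolutelyContinuousOnInterval a 0 T
  memLp : MemLp a ∞ (timeMeasure T)
  memLp_deriv : MemLp (deriv a) ∞ (timeMeasure T)

/-- The norm of `L^∞([0, T])`. -/
def normLInfty (T : ℝ) (a : ℝ → ℝ) : ℝ := (eLpNorm a ∞ (timeMeasure T)).toReal

/-- The norm of `L²([0, T]; H^s)`. -/
def normL2 {V : lattice n ħ → ℝ≥0} {s : ℝ} (T : ℝ) (f : ℝ → sobolev V s) : ℝ :=
  (eLpNorm f 2 (timeMeasure T)).toReal

/-- The time derivative `u_t` on `[0, T]` of an `H^{1+s}`-valued function, taken in `H^s`. -/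
def timeDeriv {V : lattice n ħ → ℝ≥0} {s : ℝ} (T : ℝ) (u : ℝ → sobolev V (1 + s)) (t : ℝ) :
    sobolev V s :=
  derivWithin (fun τ => sobolevIncl V s (u τ)) (Icc 0 T) t

/-- `u ∈ C([0, T]; H^{1+s}) ∩ C¹([0, T]; H^s)` solves the Cauchy problem
`u_tt + a (t) 𝓗 u + q (t) u = f`, `u (0) = u₀`, `u_t (0) = u₁`. As `f` is only `L²` in time, the
equation is understood in `H^{-∞}` for almost every `t`: for every test function `φ`, the function
`t ↦ (u_t (t), φ)` is absolutely continuous, with the derivative that the equation prescribes. -/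
structure IsSolution (V : lattice n ħ → ℝ≥0) (s T : ℝ) (a q : ℝ → ℝ) (f : ℝ → sobolev V s)
    (u₀ : sobolev V (1 + s)) (u₁ : sobolev V s) (u : ℝ → sobolev V (1 + s)) : Prop where
  continuousOn : ContinuousOn u (Icc 0 T)
  contDiffOn : ContDiffOn ℝ 1 (fun t => sobolevIncl V s (u t)) (Icc 0 T)
  absolutelyContinuous : ∀ φ : testSpace V,
    AbsolutelyContinuousOnInterval (fun t => pairing (timeDeriv T u t : distribution V) φ) 0 T
  equation : ∀ φ : testSpace V, ∀ᵐ t ∂(timeMeasure T), ∃ z : ℂ,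
    HasDerivAt (fun τ => pairing (timeDeriv T u τ : distribution V) φ) z t ∧
    z + (a t : ℂ) * pairing (hamiltonianDist V (u t : distribution V)) φ
      + (q t : ℂ) * pairing (u t : distribution V) φ = pairing (f t : distribution V) φ
  initial : u 0 = u₀
  initial_deriv : timeDeriv T u 0 = u₁

/-- The constant `C_T = c₀⁻¹ (1 + ‖a‖) exp (c₀⁻¹ (1 + ‖a'‖ + ‖q‖ + 2 ‖a‖) T)`, with
`c₀ = min {a₀, 1}` and all norms in `L^∞([0, T])`. -/
def energyConst (T a₀ : ℝ) (a q : ℝ → ℝ) : ℝ :=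
  (min a₀ 1)⁻¹ * (1 + normLInfty T a) *
    Real.exp ((min a₀ 1)⁻¹ *
      (1 + normLInfty T (deriv a) + normLInfty T q + 2 * normLInfty T a) * T)

end DiscreteSchrodinger

end

/-!
With `X = ℓ²(ħℤⁿ)`, `B = (I + 𝓗)^(-1/2)`, `U = (I + 𝓗)^((1+s)/2) u` and `W = (I + 𝓗)^(s/2) u_t`, the
Cauchy problem becomes the first order system

  `B U' = W`,  `B W' = B F - a (1 - B²) U - q B² U`

for continuous `X`-valued functions, where `B` is an injective positive contraction. The derivatives
are understood in integrated form, so that no unbounded operator appears. The equivalence of the two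
problems is `IsSolution.isMildSolution` and `IsMildSolution.isSolution`: every test function is of
the form `(I + 𝓗)^(-(1-s)/2) χ` with a test function `χ`, and the pairing with it turns the equation
into the inner product of the system with `χ` (`equation_iff`).

If `B⁻¹` is replaced by a bounded symmetric operator `D`, the system can be solved by Picard
iteration (`exists_isIntegralSolution`), and the energy `a ‖U‖² + ‖W‖²` gives an estimate
(`energy_estimate`) that does not see `D`, since the two terms with `D` in the derivative of the
energy cancel. The estimate reaches the system with `B` through the cutoffs `ψ (B)` away from the
kernel of `B`: on the range of `ψ (B)` the operator `B` is inverted by the bounded operator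
`max (B, δ)⁻¹`, and everything commutes, so `ψ (B) (U, W)` solves a bounded system, and `ψ (B) → 1`
strongly as `δ → 0` (`IsMildSolution.energy_estimate`). Uniqueness follows by linearity. For
existence the data are cut off by `ψ (B)`, the bounded system is solved, and `δ → 0`; by the energy
estimate the solutions converge uniformly on `[0, T]` (`exists_isMildSolution`).
-/

namespace DiscreteSchrodinger

open Filter Topology

/-! ### Absolutely continuous vector-valued functions -/

lemma absolutelyContinuousOnInterval_of_dist_le {X Y : Type*} [PseudoMetricSpace X]
    [PseudoMetricSpace Y] {f : ℝ → X} {g : ℝ → Y} {α β C : ℝ}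
    (hg : AbsolutelyContinuousOnInterval g α β)
    (h : ∀ x ∈ uIcc α β, ∀ y ∈ uIcc α β, dist (f x) (f y) ≤ C * dist (g x) (g y)) :
    AbsolutelyContinuousOnInterval f α β := by
  have h0 := Filter.Tendsto.const_mul C (show Tendsto _ _ _ from hg)
  simp only [mul_zero] at h0
  refine squeeze_zero' (Eventually.of_forall fun E => Finset.sum_nonneg fun _ _ => dist_nonneg)
    ?_ h0
  filter_upwards [mem_inf_of_right (mem_principal_self _)] with E hE
  rw [Finset.mul_sum]
  exact Finset.sum_le_sum fun i hi => h _ (hE.1 i hi).1 _ (hE.1 i hi).2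

lemma absolutelyContinuousOnInterval_congr {X : Type*} [PseudoMetricSpace X] {f g : ℝ → X}
    {α β : ℝ} (hg : AbsolutelyContinuousOnInterval g α β) (h : EqOn f g (uIcc α β)) :
    AbsolutelyContinuousOnInterval f α β :=
  absolutelyContinuousOnInterval_of_dist_le (C := 1) hg fun x hx y hy => by
    rw [h hx, h hy, one_mul]

lemma intervalIntegrable_of_timeMeasure {E : Type*} [NormedAddCommGroup E] {T : ℝ} {g : ℝ → E}
    (hg : Integrable g (timeMeasure T)) {s t : ℝ} (hs : s ∈ Icc 0 T) (ht : t ∈ Icc 0 T) :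
    IntervalIntegrable g volume s t := by
  have h : IntegrableOn g (Icc 0 T) := hg
  exact (h.mono_set (ordConnected_Icc.uIcc_subset hs ht)).intervalIntegrable

section Vector

variable {E : Type*} [NormedAddCommGroup E] [NormedSpace ℝ E] {T : ℝ}

lemma absolutelyContinuousOnInterval_integral {g : ℝ → E} (hT : 0 ≤ T)
    (hg : Integrable g (timeMeasure T)) (x₀ : E) :
    AbsolutelyContinuousOnInterval (fun t => x₀ + ∫ τ in (0 : ℝ)..t, g τ) 0 T := by
  have h0 : (0 : ℝ) ∈ Icc 0 T := ⟨le_rfl, hT⟩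
  have h1 := (intervalIntegrable_of_timeMeasure hg.norm h0
    ⟨hT, le_rfl⟩).absolutelyContinuousOnInterval_intervalIntegral (c := 0) left_mem_uIcc
  refine absolutelyContinuousOnInterval_of_dist_le (C := 1) h1 fun x hx y hy => ?_
  rw [uIcc_of_le hT] at hx hy
  rw [dist_add_left, one_mul, dist_eq_norm, Real.dist_eq,
    intervalIntegral.integral_interval_sub_left (intervalIntegrable_of_timeMeasure hg h0 hx)
      (intervalIntegrable_of_timeMeasure hg h0 hy),
    intervalIntegral.integral_interval_sub_left (intervalIntegrable_of_timeMeasure hg.norm h0 hx)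
      (intervalIntegrable_of_timeMeasure hg.norm h0 hy)]
  exact intervalIntegral.norm_integral_le_abs_integral_norm

lemma ae_mem_Ioo_timeMeasure : ∀ᵐ t ∂(timeMeasure T), t ∈ Ioo 0 T := by
  have h : timeMeasure T = volume.restrict (Ioo 0 T) :=
    Measure.restrict_congr_set Ioo_ae_eq_Icc.symm
  rw [h]
  exact ae_restrict_mem measurableSet_Ioo

lemma ae_timeMeasure_iff {p : ℝ → Prop} :
    (∀ᵐ t ∂(timeMeasure T), p t) ↔ ∀ᵐ t : ℝ, t ∈ Icc 0 T → p t :=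
  ae_restrict_iff' measurableSet_Icc

lemma ae_hasDerivAt_integral [CompleteSpace E] {g : ℝ → E} {f : ℝ → E} {x₀ : E} (hT : 0 ≤ T)
    (hg : Integrable g (timeMeasure T)) (hf : ∀ t ∈ Icc 0 T, f t = x₀ + ∫ τ in (0 : ℝ)..t, g τ) :
    ∀ᵐ t ∂(timeMeasure T), HasDerivAt f (g t) t := by
  have h0 : (0 : ℝ) ∈ Icc 0 T := ⟨le_rfl, hT⟩
  have h1 := (intervalIntegrable_of_timeMeasure hg h0
    ⟨hT, le_rfl⟩).ae_hasDerivAt_integral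
  rw [← uIcc_of_le hT] at h0
  filter_upwards [ae_timeMeasure_iff.2 (by rwa [← uIcc_of_le hT]), ae_mem_Ioo_timeMeasure]
    with t ht ht'
  refine ((ht 0 h0).const_add x₀).congr_of_eventuallyEq ?_
  filter_upwards [Ioo_mem_nhds ht'.1 ht'.2] with τ hτ using hf τ (Ioo_subset_Icc_self hτ)

/-- The fundamental theorem of calculus for absolutely continuous functions with values in a Banach
space, where the almost everywhere derivative has to be assumed. -/
lemma eq_integral_of_absolutelyContinuousOnInterval [CompleteSpace E] {f g : ℝ → E} (hT : 0 ≤ T)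
    (hf : AbsolutelyContinuousOnInterval f 0 T) (hg : Integrable g (timeMeasure T))
    (h : ∀ᵐ t ∂(timeMeasure T), HasDerivAt f (g t) t) {t : ℝ} (ht : t ∈ Icc 0 T) :
    f t = f 0 + ∫ τ in (0 : ℝ)..t, g τ := by
  have h1 := ae_hasDerivAt_integral (f := fun t => 0 + ∫ τ in (0 : ℝ)..t, g τ) hT hg
    fun _ _ => rfl
  obtain ⟨C, hC⟩ := (hf.fun_sub
    (absolutelyContinuousOnInterval_integral hT hg 0)).const_of_ae_hasDerivAt_zero (by
      rw [uIcc_of_le hT, ← ae_timeMeasure_iff]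
      filter_upwards [h, h1] with t h2 h3
      have h4 := h2.sub h3
      rw [sub_self] at h4
      exact h4.congr_of_eventuallyEq (Eventually.of_forall fun τ => by simp))
  have h4 := hC t (by rwa [uIcc_of_le hT])
  have h5 := hC 0 left_mem_uIcc
  simp only [intervalIntegral.integral_same, zero_add, sub_zero] at h4 h5
  rw [h5, ← h4, sub_add_cancel]

end Vector

/-! ### Essential bounds -/

lemma ae_norm_le_normLInfty {T : ℝ} {a : ℝ → ℝ} (ha : MemLp a ∞ (timeMeasure T)) :
    ∀ᵐ t ∂(timeMeasure T), |a t| ≤ normLInfty T a := by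
  have h := ha.eLpNorm_ne_top
  filter_upwards [ae_le_eLpNormEssSup (f := a) (μ := timeMeasure T)] with t ht
  rw [← eLpNorm_exponent_top] at ht
  have := ENNReal.toReal_mono h ht
  simpa [normLInfty] using this

lemma normLInfty_nonneg (T : ℝ) (a : ℝ → ℝ) : 0 ≤ normLInfty T a := ENNReal.toReal_nonneg

/-- A continuous function is bounded above by its essential bound at every point. -/
lemma le_normLInfty {T : ℝ} (hT : 0 < T) {a : ℝ → ℝ} (ha : MemLp a ∞ (timeMeasure T))
    (hc : ContinuousOn a (Icc 0 T)) {t : ℝ} (ht : t ∈ Icc 0 T) : a t ≤ normLInfty T a := by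
  have h := Measure.eqOn_Icc_of_ae_eq (μ := volume) hT.ne (f := fun t => min (a t) (normLInfty T a))
    (g := a) (by
      filter_upwards [ae_norm_le_normLInfty ha] with t ht
      exact min_eq_left ((le_abs_self _).trans ht))
    (show ContinuousOn (a ⊓ fun _ => _) _ from hc.inf continuousOn_const) hc ht
  exact min_eq_left_iff.1 h

instance (T : ℝ) : IsFiniteMeasure (timeMeasure T) := by
  unfold timeMeasure; infer_instance

/-! ### Systems of integral equations with essentially bounded coefficients -/

section System

variable {X : Type*} [NormedAddCommGroup X] [InnerProductSpace ℂ X]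

/-- `(U, W)` is continuous on `[0, T]` and satisfies there the integrated first order system
`R U' = S W`, `R W' = R F - a C₁ U - q C₂ U`, with `R U (0) = R U₀` and `R W (0) = R W₀`. -/
structure IsIntegralSolution (R S C₁ C₂ : X →L[ℂ] X) (T : ℝ) (a q : ℝ → ℝ) (F : ℝ → X)
    (U₀ W₀ : X) (U W : ℝ → X) : Prop where
  continuousOn_fst : ContinuousOn U (Icc 0 T)
  continuousOn_snd : ContinuousOn W (Icc 0 T)
  fst_eq : ∀ t ∈ Icc 0 T, R (U t) = R U₀ + ∫ τ in (0 : ℝ)..t, S (W τ)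
  snd_eq : ∀ t ∈ Icc 0 T, R (W t) =
    R W₀ + ∫ τ in (0 : ℝ)..t, (R (F τ) - (a τ : ℂ) • C₁ (U τ) - (q τ : ℂ) • C₂ (U τ))

lemma _root_.ContinuousOn.integrable_timeMeasure {E : Type*} [NormedAddCommGroup E] {T : ℝ}
    {g : ℝ → E} (hg : ContinuousOn g (Icc 0 T)) : Integrable g (timeMeasure T) :=
  hg.integrableOn_Icc

lemma _root_.ContinuousOn.integrable_clm {T : ℝ} {g : ℝ → X} (hg : ContinuousOn g (Icc 0 T))
    (S : X →L[ℂ] X) : Integrable (fun t => S (g t)) (timeMeasure T) :=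
  (S.continuous.comp_continuousOn hg).integrable_timeMeasure

lemma integrable_norm_sq {E : Type*} [NormedAddCommGroup E] {T : ℝ} {F : ℝ → E}
    (hF : MemLp F 2 (timeMeasure T)) : Integrable (fun t => ‖F t‖ ^ 2) (timeMeasure T) := by
  have := hF.integrable_norm_pow (p := 2) (by norm_num)
  exact_mod_cast this

lemma integrable_smul_of_continuousOn {T : ℝ} {a : ℝ → ℝ} (ha : MemLp a ∞ (timeMeasure T))
    {g : ℝ → X} (hg : ContinuousOn g (Icc 0 T)) :
    Integrable (fun t => (a t : ℂ) • g t) (timeMeasure T) := by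
  have h1 : MemLp g 1 (timeMeasure T) := memLp_one_iff_integrable.2 hg.integrable_timeMeasure
  have h2 : MemLp (fun t => (a t : ℂ)) ∞ (timeMeasure T) := ha.ofReal
  exact memLp_one_iff_integrable.1 (h1.smul h2)

lemma integrable_force {T : ℝ} {a q : ℝ → ℝ} (ha : MemLp a ∞ (timeMeasure T))
    (hq : MemLp q ∞ (timeMeasure T)) {F U : ℝ → X} (hF : Integrable F (timeMeasure T))
    (hU : ContinuousOn U (Icc 0 T)) (R C₁ C₂ : X →L[ℂ] X) :
    Integrable (fun τ => R (F τ) - (a τ : ℂ) • C₁ (U τ) - (q τ : ℂ) • C₂ (U τ))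
      (timeMeasure T) :=
  ((R.integrable_comp hF).sub (integrable_smul_of_continuousOn ha
    (C₁.continuous.comp_continuousOn hU))).sub (integrable_smul_of_continuousOn hq
    (C₂.continuous.comp_continuousOn hU))

namespace IsIntegralSolution

variable {T : ℝ} {a q : ℝ → ℝ} {F F' : ℝ → X} {U₀ W₀ U₀' W₀' : X} {U W U' W' : ℝ → X}
  {R S C₁ C₂ R' S' C₁' C₂' : X →L[ℂ] X}

lemma fst_zero (h : IsIntegralSolution R S C₁ C₂ T a q F U₀ W₀ U W) (hT : 0 ≤ T) :
    R (U 0) = R U₀ := by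
  simpa using h.fst_eq 0 ⟨le_rfl, hT⟩

lemma snd_zero (h : IsIntegralSolution R S C₁ C₂ T a q F U₀ W₀ U W) (hT : 0 ≤ T) :
    R (W 0) = R W₀ := by
  simpa using h.snd_eq 0 ⟨le_rfl, hT⟩

/-- Solutions are transported along intertwining operators. -/
lemma map [CompleteSpace X] (h : IsIntegralSolution R S C₁ C₂ T a q F U₀ W₀ U W)
    (ha : MemLp a ∞ (timeMeasure T)) (hq : MemLp q ∞ (timeMeasure T))
    (hF : Integrable F (timeMeasure T)) (hT : 0 ≤ T) (K K' : X →L[ℂ] X)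
    (hR : K * R = R' * K') (hS : K * S = S' * K') (h₁ : K * C₁ = C₁' * K')
    (h₂ : K * C₂ = C₂' * K') :
    IsIntegralSolution R' S' C₁' C₂' T a q (fun t => K' (F t)) (K' U₀) (K' W₀)
      (fun t => K' (U t)) (fun t => K' (W t)) := by
  have e : ∀ {P P' : X →L[ℂ] X}, K * P = P' * K' → ∀ x, P' (K' x) = K (P x) := fun h x =>
    (DFunLike.congr_fun h x).symm
  have h0 : (0 : ℝ) ∈ Icc 0 T := ⟨le_rfl, hT⟩
  refine ⟨K'.continuous.comp_continuousOn h.continuousOn_fst,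
    K'.continuous.comp_continuousOn h.continuousOn_snd, fun t ht => ?_, fun t ht => ?_⟩
  · simp only [e hR, e hS]
    rw [h.fst_eq t ht, map_add, ← K.intervalIntegral_comp_comm (intervalIntegrable_of_timeMeasure
      (h.continuousOn_snd.integrable_clm S) h0 ht)]
  · simp only [e hR, e h₁, e h₂]
    rw [h.snd_eq t ht, map_add, ← K.intervalIntegral_comp_comm (intervalIntegrable_of_timeMeasure
      (integrable_force ha hq hF h.continuousOn_fst R C₁ C₂) h0 ht)]
    simp only [map_sub, map_smul]

lemma sub (h : IsIntegralSolution R S C₁ C₂ T a q F U₀ W₀ U W)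
    (h' : IsIntegralSolution R S C₁ C₂ T a q F' U₀' W₀' U' W')
    (ha : MemLp a ∞ (timeMeasure T)) (hq : MemLp q ∞ (timeMeasure T))
    (hF : Integrable F (timeMeasure T)) (hF' : Integrable F' (timeMeasure T)) (hT : 0 ≤ T) :
    IsIntegralSolution R S C₁ C₂ T a q (fun t => F t - F' t) (U₀ - U₀') (W₀ - W₀')
      (fun t => U t - U' t) (fun t => W t - W' t) := by
  have h0 : (0 : ℝ) ∈ Icc 0 T := ⟨le_rfl, hT⟩
  refine ⟨h.continuousOn_fst.sub h'.continuousOn_fst,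
    h.continuousOn_snd.sub h'.continuousOn_snd, fun t ht => ?_, fun t ht => ?_⟩
  · simp only [map_sub]
    rw [intervalIntegral.integral_sub (intervalIntegrable_of_timeMeasure
        (h.continuousOn_snd.integrable_clm S) h0 ht)
      (intervalIntegrable_of_timeMeasure
        (h'.continuousOn_snd.integrable_clm S) h0 ht),
      h.fst_eq t ht, h'.fst_eq t ht]
    abel
  · have e := intervalIntegral.integral_sub (intervalIntegrable_of_timeMeasure
        (integrable_force ha hq hF h.continuousOn_fst R C₁ C₂) h0 ht)
      (intervalIntegrable_of_timeMeasure
        (integrable_force ha hq hF' h'.continuousOn_fst R C₁ C₂) h0 ht)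
    rw [map_sub, h.snd_eq t ht, h'.snd_eq t ht, map_sub, add_sub_add_comm, ← e]
    congr 1
    refine intervalIntegral.integral_congr fun τ _ => ?_
    simp only [map_sub, smul_sub]
    abel

end IsIntegralSolution

/-! ### The energy estimate -/

lemma absolutelyContinuousOnInterval_norm_sq {E : Type*} [NormedAddCommGroup E] {T : ℝ} {U : ℝ → E}
    (hU : AbsolutelyContinuousOnInterval U 0 T) :
    AbsolutelyContinuousOnInterval (fun t => ‖U t‖ ^ 2) 0 T := by
  obtain ⟨C, hC⟩ := hU.exists_bound
  refine absolutelyContinuousOnInterval_of_dist_le (C := 2 * C) hU fun x hx y hy => ?_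
  rw [Real.dist_eq, dist_eq_norm, sq_sub_sq, abs_mul, abs_of_nonneg (by positivity)]
  exact mul_le_mul (by linarith [hC x hx, hC y hy]) (abs_norm_sub_norm_le _ _) (abs_nonneg _)
    (by linarith [hC x hx, norm_nonneg (U x)])

lemma hasDerivAt_norm_sq {U : ℝ → X} {U' : X} {t : ℝ} (h : HasDerivAt U U' t) :
    HasDerivAt (fun t => ‖U t‖ ^ 2) (2 * (⟪U t, U'⟫_ℂ).re) t := by
  have h1 := Complex.reCLM.hasFDerivAt.comp_hasDerivAt t (h.inner ℂ h)
  have h2 : (fun t => ‖U t‖ ^ 2) = ⇑Complex.reCLM ∘ fun t => ⟪U t, U t⟫_ℂ := by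
    ext t; exact norm_sq_eq_re_inner (𝕜 := ℂ) (U t)
  rw [h2]
  refine h1.congr_deriv ?_
  rw [← inner_conj_symm U' (U t)]
  simp only [Complex.reCLM_apply, Complex.add_re, Complex.conj_re]
  ring

/-- The bound for the derivative of the energy `E = α u² + w²`; here `u`, `w`, `φ` stand for `‖U‖`,
`‖W‖`, `‖F‖`, the numbers `α`, `α'`, `ρ` for `a`, `a'`, `q`, and `i`, `j` for the real parts of
`(W, B U)` and `(W, F)`. -/
lemma energy_rate_le {u w φ A A' Q c₀ α α' ρ E i j : ℝ}
    (hα : |α| ≤ A) (hα' : |α'| ≤ A') (hρ : |ρ| ≤ Q) (hc : 0 < c₀)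
    (hE : c₀ * (u ^ 2 + w ^ 2) ≤ E) (hi : |i| ≤ w * u) (hj : |j| ≤ w * φ) :
    α' * u ^ 2 + 2 * j + 2 * (α - ρ) * i ≤ c₀⁻¹ * (1 + A' + Q + 2 * A) * E + φ ^ 2 := by
  have hA : 0 ≤ A := (abs_nonneg _).trans hα
  have hA' : 0 ≤ A' := (abs_nonneg _).trans hα'
  have hQ : 0 ≤ Q := (abs_nonneg _).trans hρ
  have h1 : α' * u ^ 2 ≤ A' * u ^ 2 :=
    mul_le_mul_of_nonneg_right ((le_abs_self _).trans hα') (sq_nonneg u)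
  have h2 : (α - ρ) * i ≤ (A + Q) * (w * u) := by
    refine (le_abs_self _).trans ?_
    rw [abs_mul]
    exact mul_le_mul ((abs_sub _ _).trans (add_le_add hα hρ)) hi (abs_nonneg _) (by positivity)
  have h3 : (1 + A' + Q + 2 * A) * (u ^ 2 + w ^ 2) ≤ c₀⁻¹ * (1 + A' + Q + 2 * A) * E := by
    rw [mul_right_comm, mul_comm _ (1 + A' + Q + 2 * A)]
    exact mul_le_mul_of_nonneg_left ((le_inv_mul_iff₀ hc).2 hE) (by positivity)
  have h4 := (le_abs_self _).trans hj
  have h5 : (A + Q) * (2 * (w * u)) ≤ (A + Q) * (u ^ 2 + w ^ 2) :=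
    mul_le_mul_of_nonneg_left (by nlinarith [sq_nonneg (u - w)]) (by positivity)
  nlinarith [sq_nonneg (w - φ), mul_nonneg hA' (sq_nonneg w), mul_nonneg hA (sq_nonneg w),
    mul_nonneg hA (sq_nonneg u)]

/-- The energy estimate for the system `U' = D W`, `W' = F - a (D - B) U - q B U` with `D` symmetric
and `B` a contraction. The energy is `a ‖U‖² + ‖W‖²`; by symmetry the contributions of `D` to its
derivative cancel, so that the bound does not depend on `D`. -/
theorem energy_estimate [CompleteSpace X] {T : ℝ} (hT : 0 < T) {a q : ℝ → ℝ} {a₀ : ℝ}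
    (ha : MemLInftyOne T a) (ha₀ : 0 < a₀) (hinf : ∀ t ∈ Icc 0 T, a₀ ≤ a t)
    (hq : MemLp q ∞ (timeMeasure T)) {D B : X →L[ℂ] X}
    (hD : ∀ x y, ⟪D x, y⟫_ℂ = ⟪x, D y⟫_ℂ) (hB : ∀ x, ‖B x‖ ≤ ‖x‖)
    {F : ℝ → X} (hF : MemLp F 2 (timeMeasure T)) {U₀ W₀ : X} {U W : ℝ → X}
    (h : IsIntegralSolution 1 D (D - B) B T a q F U₀ W₀ U W) {t : ℝ} (ht : t ∈ Icc 0 T) :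
    ‖U t‖ ^ 2 + ‖W t‖ ^ 2 ≤
      energyConst T a₀ a q * (‖U₀‖ ^ 2 + ‖W₀‖ ^ 2 + ∫ τ in (0 : ℝ)..T, ‖F τ‖ ^ 2) := by
  have hF1 : Integrable F (timeMeasure T) := hF.integrable (by norm_num)
  have hF2 := integrable_norm_sq hF
  have h0 : (0 : ℝ) ∈ Icc 0 T := ⟨le_rfl, hT.le⟩
  have hTT : T ∈ Icc 0 T := ⟨hT.le, le_rfl⟩
  have hDW := h.continuousOn_snd.integrable_clm D
  have hG := integrable_force ha.memLp hq hF1 h.continuousOn_fst 1 (D - B) B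
  have hac : ContinuousOn a (Icc 0 T) := by
    have := ha.absolutelyContinuous.continuousOn
    rwa [uIcc_of_le hT.le] at this
  have hU0 : U 0 = U₀ := h.fst_zero hT.le
  have hW0 : W 0 = W₀ := h.snd_zero hT.le
  have acU : AbsolutelyContinuousOnInterval U 0 T :=
    absolutelyContinuousOnInterval_congr
      (absolutelyContinuousOnInterval_integral hT.le hDW U₀) (by
        rw [uIcc_of_le hT.le]; exact fun t ht => h.fst_eq t ht)
  have acW : AbsolutelyContinuousOnInterval W 0 T :=
    absolutelyContinuousOnInterval_congr
      (absolutelyContinuousOnInterval_integral hT.le hG W₀) (by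
        rw [uIcc_of_le hT.le]; exact fun t ht => h.snd_eq t ht)
  set c₀ := min a₀ 1 with hc₀
  have hc : 0 < c₀ := lt_min ha₀ one_pos
  set A := normLInfty T a
  have hA : 0 ≤ A := normLInfty_nonneg T a
  set κ := c₀⁻¹ * (1 + normLInfty T (deriv a) + normLInfty T q + 2 * A) with hκ
  have hκ0 : 0 ≤ κ := by
    have := normLInfty_nonneg T (deriv a)
    have := normLInfty_nonneg T q
    positivity
  set e : ℝ → ℝ := fun t => a t * ‖U t‖ ^ 2 + ‖W t‖ ^ 2 with he
  have hce : ∀ t ∈ Icc 0 T, c₀ * (‖U t‖ ^ 2 + ‖W t‖ ^ 2) ≤ e t := fun t ht => by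
    rw [mul_add]
    refine add_le_add (mul_le_mul_of_nonneg_right ((min_le_left _ _).trans (hinf t ht))
      (sq_nonneg _)) ?_
    nlinarith [min_le_right a₀ 1, sq_nonneg ‖W t‖]
  have ace : AbsolutelyContinuousOnInterval e 0 T :=
    (ha.absolutelyContinuous.fun_mul (absolutelyContinuousOnInterval_norm_sq acU)).fun_add
      (absolutelyContinuousOnInterval_norm_sq acW)
  have acg : AbsolutelyContinuousOnInterval (fun t => Real.exp (-κ * t) * e t) 0 T :=
    (ContDiff.contDiffOn (by fun_prop)).absolutelyContinuousOnInterval.fun_mul ace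
  have hder : ∀ᵐ t ∂(timeMeasure T), deriv (fun t => Real.exp (-κ * t) * e t) t ≤ ‖F t‖ ^ 2 := by
    filter_upwards [ae_hasDerivAt_integral hT.le hDW h.fst_eq,
      ae_hasDerivAt_integral hT.le hG h.snd_eq,
      ae_timeMeasure_iff.2 (by simpa [uIcc_of_le hT.le] using
        ha.absolutelyContinuous.ae_differentiableAt),
      ae_norm_le_normLInfty ha.memLp, ae_norm_le_normLInfty ha.memLp_deriv,
      ae_norm_le_normLInfty hq, ae_mem_Ioo_timeMeasure] with t dU dW da b1 b2 b3 ht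
    change HasDerivAt U (D (W t)) t at dU
    change HasDerivAt W _ t at dW
    have de := (da.hasDerivAt.mul (hasDerivAt_norm_sq dU)).add (hasDerivAt_norm_sq dW)
    have dexp : HasDerivAt (fun t => Real.exp (-κ * t)) (Real.exp (-κ * t) * (-κ)) t := by
      simpa using ((hasDerivAt_id t).const_mul (-κ)).exp
    have dg : HasDerivAt (fun t => Real.exp (-κ * t) * e t) _ t := dexp.mul de
    rw [dg.deriv]
    have hrate := energy_rate_le (u := ‖U t‖) (w := ‖W t‖) (φ := ‖F t‖) b1 b2 b3 hc
      (hce t (Ioo_subset_Icc_self ht)) (i := (⟪W t, B (U t)⟫_ℂ).re) (j := (⟪W t, F t⟫_ℂ).re)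
      ((Complex.abs_re_le_norm _).trans ((norm_inner_le_norm _ _).trans
        (mul_le_mul_of_nonneg_left (hB _) (norm_nonneg _))))
      ((Complex.abs_re_le_norm _).trans (norm_inner_le_norm _ _))
    -- To the energy rate, `U'` contributes `2 a Re (U, D W)` and `W'` contributes
    -- `-2 a Re (W, D U)`.
    have hsymm : (⟪W t, D (U t)⟫_ℂ).re = (⟪U t, D (W t)⟫_ℂ).re := by
      rw [← hD, ← inner_conj_symm, Complex.conj_re]
    have hexp1 : Real.exp (-κ * t) ≤ 1 := Real.exp_le_one_iff.2 (by nlinarith [ht.1])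
    have hexp0 := Real.exp_pos (-κ * t)
    simp only [one_apply_eq_self, sub_apply, inner_sub_right,
      inner_smul_right, Complex.sub_re, Complex.re_ofReal_mul, hsymm]
    have hr2 : deriv a t * ‖U t‖ ^ 2 + a t * (2 * (⟪U t, D (W t)⟫_ℂ).re) +
        2 * ((⟪W t, F t⟫_ℂ).re - a t * ((⟪U t, D (W t)⟫_ℂ).re - (⟪W t, B (U t)⟫_ℂ).re)
          - q t * (⟪W t, B (U t)⟫_ℂ).re) - κ * e t ≤ ‖F t‖ ^ 2 := by
      rw [hκ]; linarith [hrate]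
    calc _ = Real.exp (-κ * t) * (deriv a t * ‖U t‖ ^ 2 + a t * (2 * (⟪U t, D (W t)⟫_ℂ).re) +
        2 * ((⟪W t, F t⟫_ℂ).re - a t * ((⟪U t, D (W t)⟫_ℂ).re - (⟪W t, B (U t)⟫_ℂ).re)
          - q t * (⟪W t, B (U t)⟫_ℂ).re) - κ * e t) := by
          simp only [he]; ring
      _ ≤ Real.exp (-κ * t) * ‖F t‖ ^ 2 := mul_le_mul_of_nonneg_left hr2 hexp0.le
      _ ≤ ‖F t‖ ^ 2 := mul_le_of_le_one_left (sq_nonneg _) hexp1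
  have hint : Real.exp (-κ * t) * e t - e 0 ≤ ∫ τ in (0 : ℝ)..T, ‖F τ‖ ^ 2 := by
    have h1 := (acg.mono (c := 0) (d := t) (by
      rw [uIcc_of_le hT.le, uIcc_of_le ht.1]; exact Icc_subset_Icc_right ht.2))
    have h2 := h1.integral_deriv_eq_sub
    simp only [mul_zero, Real.exp_zero, one_mul] at h2
    rw [← h2]
    refine (intervalIntegral.integral_mono_ae_restrict ht.1 h1.intervalIntegrable_deriv
      (intervalIntegrable_of_timeMeasure hF2 h0 ht) ?_).trans ?_
    · exact ae_restrict_of_ae_restrict_of_subset (Icc_subset_Icc_right ht.2) hder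
    · exact intervalIntegral.integral_mono_interval le_rfl ht.1 ht.2
        (Eventually.of_forall fun _ => sq_nonneg _) (intervalIntegrable_of_timeMeasure hF2 h0 hTT)
  have he0 : e 0 ≤ (1 + A) * (‖U₀‖ ^ 2 + ‖W₀‖ ^ 2) := by
    have := le_normLInfty hT ha.memLp hac h0
    simp only [he, hU0, hW0]
    nlinarith [sq_nonneg ‖U₀‖, sq_nonneg ‖W₀‖, mul_nonneg hA (sq_nonneg ‖W₀‖),
      mul_le_mul_of_nonneg_right this (sq_nonneg ‖U₀‖)]
  set Φ := ∫ τ in (0 : ℝ)..T, ‖F τ‖ ^ 2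
  have hΦ : 0 ≤ Φ := intervalIntegral.integral_nonneg hT.le fun _ _ => sq_nonneg _
  have hfin : e t ≤ Real.exp (κ * T) * ((1 + A) * (‖U₀‖ ^ 2 + ‖W₀‖ ^ 2 + Φ)) := by
    have h1 : Real.exp (-κ * t) * e t ≤ (1 + A) * (‖U₀‖ ^ 2 + ‖W₀‖ ^ 2 + Φ) := by
      nlinarith [mul_nonneg hA hΦ]
    calc e t = Real.exp (κ * t) * (Real.exp (-κ * t) * e t) := by
          rw [← mul_assoc, ← Real.exp_add]; simp
      _ ≤ Real.exp (κ * t) * ((1 + A) * (‖U₀‖ ^ 2 + ‖W₀‖ ^ 2 + Φ)) :=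
          mul_le_mul_of_nonneg_left h1 (Real.exp_pos _).le
      _ ≤ _ := mul_le_mul_of_nonneg_right
          (Real.exp_le_exp.2 (mul_le_mul_of_nonneg_left ht.2 hκ0)) (by positivity)
  have := (le_inv_mul_iff₀ hc).2 ((hce t ht).trans hfin)
  refine this.trans (le_of_eq ?_)
  rw [energyConst]
  ring

end System

/-! ### Existence for integral equations with Lipschitz right-hand side -/

/-- Carathéodory's form of the Picard–Lindelöf theorem: `x' = G (t, x)` has an absolutely
continuous solution on `[0, T]` if `G` is Lipschitz in `x`, uniformly in almost every `t`. The
Picard map is a contraction for the sup norm with weight `exp (-2 M t)`. -/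
theorem exists_integral_solution {E : Type*} [NormedAddCommGroup E] [NormedSpace ℝ E]
    [CompleteSpace E] {T : ℝ} (hT : 0 ≤ T) (G : ℝ → E → E) {M : ℝ} (hM : 0 < M)
    (hint : ∀ x : ℝ → E, ContinuousOn x (Icc 0 T) →
      Integrable (fun τ => G τ (x τ)) (timeMeasure T))
    (hlip : ∀ᵐ τ ∂(timeMeasure T), ∀ x y, ‖G τ x - G τ y‖ ≤ M * ‖x - y‖) (x₀ : E) :
    ∃ x : ℝ → E, ContinuousOn x (Icc 0 T) ∧
      ∀ t ∈ Icc 0 T, x t = x₀ + ∫ τ in (0 : ℝ)..t, G τ (x τ) := by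
  have h0 : (0 : ℝ) ∈ Icc 0 T := ⟨le_rfl, hT⟩
  let ext : C(Icc 0 T, E) → ℝ → E := fun z τ => Real.exp (2 * M * τ) • IccExtend hT z τ
  have hext : ∀ z, ContinuousOn (ext z) (Icc 0 T) := fun z => by
    have := z.continuous
    exact Continuous.continuousOn (by fun_prop)
  have hI : ∀ z, Integrable (fun τ => G τ (ext z τ)) (timeMeasure T) := fun z => hint _ (hext z)
  let Φ : C(Icc 0 T, E) → C(Icc 0 T, E) := fun z =>
    ⟨fun t => Real.exp (-(2 * M * t)) • (x₀ + ∫ τ in (0 : ℝ)..t, G τ (ext z τ)), by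
      have h1 := (absolutelyContinuousOnInterval_integral hT (hI z) x₀).continuousOn
      rw [uIcc_of_le hT] at h1
      have h2 : Continuous fun t : Icc 0 T => Real.exp (-(2 * M * (t : ℝ))) := by fun_prop
      exact h2.smul (continuousOn_iff_continuous_domRestrict.1 h1)⟩
  have hΦ : ContractingWith (1 / 2) Φ := by
    refine ⟨by rw [← NNReal.coe_lt_coe]; norm_num, LipschitzWith.of_dist_le_mul fun z z' => ?_⟩
    rw [ContinuousMap.dist_le (by positivity)]
    intro t
    have hsub : IntervalIntegrable (fun τ => Real.exp (2 * M * τ)) volume 0 t :=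
      Continuous.intervalIntegrable (by fun_prop) _ _
    rw [dist_eq_norm]
    change ‖Real.exp (-(2 * M * t)) • (x₀ + ∫ τ in (0 : ℝ)..t, G τ (ext z τ)) -
      Real.exp (-(2 * M * t)) • (x₀ + ∫ τ in (0 : ℝ)..t, G τ (ext z' τ))‖ ≤ _
    rw [← smul_sub, add_sub_add_left_eq_sub, ← intervalIntegral.integral_sub
      (intervalIntegrable_of_timeMeasure (hI z) h0 t.2)
      (intervalIntegrable_of_timeMeasure (hI z') h0 t.2), norm_smul,
      Real.norm_of_nonneg (Real.exp_pos _).le]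
    have h1 : ‖∫ τ in (0 : ℝ)..t, (G τ (ext z τ) - G τ (ext z' τ))‖ ≤
        ∫ τ in (0 : ℝ)..t, M * dist z z' * Real.exp (2 * M * τ) := by
      refine intervalIntegral.norm_integral_le_of_norm_le t.2.1 ?_ (hsub.const_mul _)
      filter_upwards [ae_timeMeasure_iff.1 hlip] with τ hτ hτt
      refine (hτ ⟨hτt.1.le, hτt.2.trans t.2.2⟩ _ _).trans ?_
      rw [mul_assoc]
      refine mul_le_mul_of_nonneg_left ?_ hM.le
      change ‖Real.exp (2 * M * τ) • z _ - Real.exp (2 * M * τ) • z' _‖ ≤ _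
      rw [← smul_sub, norm_smul, Real.norm_of_nonneg (Real.exp_pos _).le, mul_comm, ← dist_eq_norm]
      exact mul_le_mul_of_nonneg_right (z.dist_apply_le_dist _) (Real.exp_pos _).le
    have h2 : ∫ τ in (0 : ℝ)..t, M * dist z z' * Real.exp (2 * M * τ) =
        dist z z' / 2 * (Real.exp (2 * M * t) - 1) := by
      rw [intervalIntegral.integral_const_mul,
        intervalIntegral.integral_comp_mul_left (fun x => Real.exp x) (by positivity), integral_exp]
      simp only [mul_zero, Real.exp_zero, smul_eq_mul]
      field_simp
    calc _ ≤ Real.exp (-(2 * M * t)) * (dist z z' / 2 * (Real.exp (2 * M * t) - 1)) :=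
          mul_le_mul_of_nonneg_left (h1.trans_eq h2) (Real.exp_pos _).le
      _ = dist z z' / 2 * (1 - Real.exp (-(2 * M * t))) := by
          have : Real.exp (-(2 * M * t)) * Real.exp (2 * M * t) = 1 := by
            rw [← Real.exp_add]; simp
          linear_combination (dist z z' / 2) * this
      _ ≤ dist z z' / 2 * 1 := by
          gcongr
          linarith [Real.exp_pos (-(2 * M * t))]
      _ = _ := by simp; ring
  obtain ⟨z, hz, -⟩ := hΦ.exists_fixedPoint 0 (edist_ne_top _ _)
  refine ⟨ext z, hext z, fun t ht => ?_⟩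
  have h : Real.exp (-(2 * M * t)) • (x₀ + ∫ τ in (0 : ℝ)..t, G τ (ext z τ)) = z ⟨t, ht⟩ :=
    congrArg (fun z : C(Icc 0 T, E) => z ⟨t, ht⟩) hz.eq
  change Real.exp (2 * M * t) • IccExtend hT z t = _
  rw [IccExtend_of_mem hT _ ht, ← h, smul_smul, ← Real.exp_add]
  simp

/-- Existence for systems whose leading operator `R` is the identity. -/
lemma exists_isIntegralSolution {X : Type*} [NormedAddCommGroup X] [InnerProductSpace ℂ X]
    [CompleteSpace X] {T : ℝ} (hT : 0 ≤ T) {a q : ℝ → ℝ} (ha : MemLp a ∞ (timeMeasure T))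
    (hq : MemLp q ∞ (timeMeasure T)) {F : ℝ → X} (hF : Integrable F (timeMeasure T))
    (S C₁ C₂ : X →L[ℂ] X) (U₀ W₀ : X) :
    ∃ U W, IsIntegralSolution 1 S C₁ C₂ T a q F U₀ W₀ U W := by
  have h0 : (0 : ℝ) ∈ Icc 0 T := ⟨le_rfl, hT⟩
  let G : ℝ → X × X → X × X := fun τ x =>
    (S x.2, F τ - (a τ : ℂ) • C₁ x.1 - (q τ : ℂ) • C₂ x.1)
  have hint : ∀ x : ℝ → X × X, ContinuousOn x (Icc 0 T) →
      Integrable (fun τ => G τ (x τ)) (timeMeasure T) := fun x hx =>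
    (hx.snd.integrable_clm S).prodMk (integrable_force ha hq hF hx.fst 1 C₁ C₂)
  obtain ⟨x, hx, h⟩ := exists_integral_solution hT G
    (M := 1 + ‖S‖ + normLInfty T a * ‖C₁‖ + normLInfty T q * ‖C₂‖) (by
      have := normLInfty_nonneg T a
      have := normLInfty_nonneg T q
      positivity) hint (by
    filter_upwards [ae_norm_le_normLInfty ha, ae_norm_le_normLInfty hq] with τ h1 h2 x y
    have e : G τ x - G τ y = (S (x - y).2,
        -((a τ : ℂ) • C₁ (x - y).1 + (q τ : ℂ) • C₂ (x - y).1)) := by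
      ext1
      · simp [G]
      · simp only [G, Prod.snd_sub, Prod.fst_sub, map_sub, smul_sub]
        abel
    have hA := (abs_nonneg _).trans h1
    have hQ := (abs_nonneg _).trans h2
    have n1 := norm_fst_le (x - y)
    have n2 := norm_snd_le (x - y)
    rw [e, Prod.norm_def]
    refine max_le ?_ ?_
    · calc ‖S (x - y).2‖ ≤ ‖S‖ * ‖x - y‖ := S.le_opNorm_of_le n2
        _ ≤ _ := by
          gcongr
          nlinarith [norm_nonneg C₁, norm_nonneg C₂, mul_nonneg hA (norm_nonneg C₁),
            mul_nonneg hQ (norm_nonneg C₂)]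
    · rw [norm_neg]
      calc _ ≤ normLInfty T a * (‖C₁‖ * ‖x - y‖) + normLInfty T q * (‖C₂‖ * ‖x - y‖) := by
            refine (norm_add_le _ _).trans (add_le_add ?_ ?_)
            · rw [norm_smul, Complex.norm_real]
              exact mul_le_mul h1 (C₁.le_opNorm_of_le n1) (norm_nonneg _) hA
            · rw [norm_smul, Complex.norm_real]
              exact mul_le_mul h2 (C₂.le_opNorm_of_le n1) (norm_nonneg _) hQ
        _ ≤ _ := by
          nlinarith [norm_nonneg (x - y), mul_nonneg (norm_nonneg S) (norm_nonneg (x - y))])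
    (U₀, W₀)
  have hI : ∀ t ∈ Icc 0 T, IntervalIntegrable (fun τ => G τ (x τ)) volume 0 t := fun t ht =>
    intervalIntegrable_of_timeMeasure (hint x hx) h0 ht
  refine ⟨fun t => (x t).1, fun t => (x t).2, hx.fst, hx.snd, fun t ht => ?_, fun t ht => ?_⟩
  · have h1 := congrArg Prod.fst (h t ht)
    rw [Prod.fst_add, ← ContinuousLinearMap.coe_fst' (R := ℝ),
      ← ContinuousLinearMap.intervalIntegral_comp_comm _ (hI t ht)] at h1
    exact h1
  · have h1 := congrArg Prod.snd (h t ht)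
    rw [Prod.snd_add, ← ContinuousLinearMap.coe_snd' (R := ℝ),
      ← ContinuousLinearMap.intervalIntegral_comp_comm _ (hI t ht)] at h1
    exact h1

/-! ### Spectral cutoffs of a positive contraction -/

section Cutoff

variable {X : Type*} [NormedAddCommGroup X] [InnerProductSpace ℂ X] [CompleteSpace X]

/-- The bounded approximation `max (B, δ)⁻¹` of the unbounded operator `B⁻¹`. -/
noncomputable def truncInv (B : X →L[ℂ] X) (δ : ℝ) : X →L[ℂ] X := cfc (fun r : ℝ => (max r δ)⁻¹) B

/-- The cutoff `ψ (B)`, where `ψ` vanishes on `(-∞, δ]`, equals `1` on `[2δ, ∞)` and is affine in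
between. -/
noncomputable def specCutoff (B : X →L[ℂ] X) (δ : ℝ) : X →L[ℂ] X :=
  cfc (fun r : ℝ => max 0 (min 1 (r / δ - 1))) B

variable {B : X →L[ℂ] X} {δ : ℝ}

lemma continuous_truncInv (hδ : 0 < δ) : Continuous fun r : ℝ => (max r δ)⁻¹ :=
  (continuous_id.max continuous_const).inv₀ fun _ => (lt_max_of_lt_right hδ).ne'

lemma continuous_specCutoff (δ : ℝ) : Continuous fun r : ℝ => max 0 (min 1 (r / δ - 1)) := by
  fun_prop

lemma commute_cfc (hB : 0 ≤ B) (f : ℝ → ℝ) : Commute (cfc f B) B := by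
  have h := cfc_commute_cfc f id B
  rwa [cfc_id ℝ B] at h

lemma truncInv_symm (x y : X) : ⟪truncInv B δ x, y⟫_ℂ = ⟪x, truncInv B δ y⟫_ℂ :=
  (show IsSelfAdjoint (truncInv B δ) from cfc_predicate _ B).isSymmetric x y

/-- On the range of the cutoff `ψ (B)`, the operator `max (B, δ)⁻¹` inverts `B`. -/
lemma truncInv_mul_specCutoff (hB : 0 ≤ B) (hδ : 0 < δ) :
    truncInv B δ * specCutoff B δ * B = specCutoff B δ := by
  have h1 := (continuous_truncInv hδ).continuousOn (s := spectrum ℝ B)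
  have h2 := (continuous_specCutoff δ).continuousOn (s := spectrum ℝ B)
  rw [truncInv, specCutoff, ← cfc_mul _ _ B h1 h2]
  nth_rw 2 [← cfc_id ℝ B]
  rw [← cfc_mul (fun r => (max r δ)⁻¹ * max 0 (min 1 (r / δ - 1))) _ B (h1.mul h2) continuousOn_id]
  refine cfc_congr fun r _ => ?_
  rcases le_total r δ with h | h
  · have : max 0 (min 1 (r / δ - 1)) = 0 := by
      rw [max_eq_left]
      exact (min_le_right _ _).trans (by linarith [(div_le_one hδ).2 h])
    simp [this]
  · have : r ≠ 0 := (hδ.trans_le h).ne'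
    simp only [max_eq_left h, id]
    field_simp

lemma norm_specCutoff_le (B : X →L[ℂ] X) (δ : ℝ) : ‖specCutoff B δ‖ ≤ 1 :=
  norm_cfc_le zero_le_one fun r _ => by
    rw [Real.norm_of_nonneg (le_max_left _ _)]
    exact max_le zero_le_one (min_le_left _ _)

lemma norm_specCutoff_mul_sub_le (hB : 0 ≤ B) (hδ : 0 < δ) :
    ‖specCutoff B δ * B - B‖ ≤ 2 * δ := by
  have h2 := (continuous_specCutoff δ).continuousOn (s := spectrum ℝ B)
  have e : specCutoff B δ * B - B =
      cfc (fun r : ℝ => max 0 (min 1 (r / δ - 1)) * id r - id r) B := by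
    rw [cfc_sub (fun r => max 0 (min 1 (r / δ - 1)) * id r) _ B (h2.mul continuousOn_id)
      continuousOn_id, cfc_mul _ _ B h2 continuousOn_id,
      cfc_id ℝ B]
    rfl
  rw [e]
  refine norm_cfc_le (by positivity) fun r hr => ?_
  have hr0 : 0 ≤ r := spectrum_nonneg_of_nonneg hB hr
  simp only [id]
  rw [show ∀ c : ℝ, c * r - r = -((1 - c) * r) from fun c => by ring, norm_neg]
  have h1 : max 0 (min 1 (r / δ - 1)) ≤ 1 := max_le zero_le_one (min_le_left _ _)
  rw [Real.norm_of_nonneg (mul_nonneg (by linarith) hr0)]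
  rcases le_total r (2 * δ) with h | h
  · nlinarith [le_max_left 0 (min 1 (r / δ - 1))]
  · have : (1 : ℝ) ≤ r / δ - 1 := by
      rw [le_sub_iff_add_le, le_div_iff₀ hδ]; linarith
    rw [min_eq_left this, max_eq_right zero_le_one, sub_self, zero_mul]
    positivity

lemma denseRange_of_injective (hB : 0 ≤ B) (hinj : Function.Injective B) : DenseRange B := by
  have h := ((ContinuousLinearMap.nonneg_iff_isPositive B).1 hB).isSymmetric
  have : (LinearMap.range (B : X →ₗ[ℂ] X)).topologicalClosure = ⊤ := by
    rw [Submodule.topologicalClosure_eq_top_iff, Submodule.eq_bot_iff]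
    intro x hx
    apply hinj
    rw [map_zero, ← inner_self_eq_zero (𝕜 := ℂ)]
    rw [Submodule.mem_orthogonal] at hx
    have h1 := hx (B (B x)) ⟨_, rfl⟩
    exact (h (B x) x).symm.trans h1
  rw [← Submodule.dense_iff_topologicalClosure_eq_top] at this
  exact this

lemma tendsto_specCutoff (hB : 0 ≤ B) (hinj : Function.Injective B) (x : X) :
    Tendsto (fun m : ℕ => specCutoff B (1 / ((m : ℝ) + 1)) x) atTop (𝓝 x) := by
  rw [Metric.tendsto_atTop]
  intro ε hε
  -- The range of `B` is dense, and on `B y` the error is at most `2 δ ‖y‖`.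
  obtain ⟨y, hy⟩ := (denseRange_of_injective hB hinj).exists_dist_lt x
    (show 0 < ε / 3 by positivity)
  have h0 : Tendsto (fun m : ℕ => 2 * (1 / ((m : ℝ) + 1)) * ‖y‖) atTop (𝓝 0) := by
    simpa using (tendsto_one_div_add_atTop_nhds_zero_nat.const_mul 2).mul_const ‖y‖
  obtain ⟨N, hN⟩ :=
    (h0.eventually (gt_mem_nhds (show 0 < ε / 3 by positivity))).exists_forall_of_atTop
  refine ⟨N, fun m hm => ?_⟩
  set Q := specCutoff B (1 / ((m : ℝ) + 1))
  have h1 : ‖Q (x - B y)‖ ≤ ‖x - B y‖ := by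
    simpa using Q.le_of_opNorm_le (norm_specCutoff_le B _) (x - B y)
  have h2 : ‖Q (B y) - B y‖ ≤ 2 * (1 / ((m : ℝ) + 1)) * ‖y‖ :=
    (Q * B - B).le_of_opNorm_le (norm_specCutoff_mul_sub_le hB (by positivity)) y
  have e : Q x - x = Q (x - B y) + (Q (B y) - B y) - (x - B y) := by
    rw [map_sub]; abel
  rw [dist_eq_norm] at hy ⊢
  rw [e]
  have h3 := norm_sub_le (Q (x - B y) + (Q (B y) - B y)) (x - B y)
  have h4 := norm_add_le (Q (x - B y)) (Q (B y) - B y)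
  linarith [hN m hm]

end Cutoff

/-! ### The degenerate system `B U' = W`, `B W' = B F - a (1 - B²) U - q B² U` -/

/-- Completeness of continuous functions under uniform convergence, for squared distances as they
come from an energy estimate. -/
lemma exists_tendstoUniformlyOn {E : Type*} [NormedAddCommGroup E] [CompleteSpace E] {s : Set ℝ}
    {Z : ℕ → ℝ → E} (hZ : ∀ m, ContinuousOn (Z m) s) {C : ℝ} {δ : ℕ → ℝ}
    (hδ : Tendsto δ atTop (𝓝 0)) (h : ∀ m k : ℕ, ∀ t ∈ s, ‖Z m t - Z k t‖ ^ 2 ≤ C * (δ m + δ k)) :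
    ∃ Y : ℝ → E, ContinuousOn Y s ∧ TendstoUniformlyOn Z Y atTop s := by
  have hc : UniformCauchySeqOn Z atTop s := by
    rw [Metric.uniformCauchySeqOn_iff]
    intro ε hε
    have h1 : Tendsto (fun p : ℕ × ℕ => C * (δ p.1 + δ p.2)) (atTop ×ˢ atTop) (𝓝 0) := by
      simpa using ((hδ.comp tendsto_fst).add (hδ.comp tendsto_snd)).const_mul C
    have h2 := h1.eventually (gt_mem_nhds (show 0 < ε ^ 2 by positivity))
    rw [prod_atTop_atTop_eq, eventually_atTop] at h2
    obtain ⟨⟨M, N⟩, hMN⟩ := h2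
    refine ⟨max M N, fun m hm k hk t ht => ?_⟩
    rw [dist_eq_norm]
    exact lt_of_pow_lt_pow_left₀ 2 hε.le ((h m k t ht).trans_lt
      (hMN (m, k) ⟨(le_max_left _ _).trans hm, (le_max_right _ _).trans hk⟩))
  have hex : ∀ t, ∃ y : E, t ∈ s → Tendsto (fun m => Z m t) atTop (𝓝 y) := fun t => by
    by_cases ht : t ∈ s
    · exact (cauchySeq_tendsto_of_complete (hc.cauchySeq ht)).imp fun _ hy _ => hy
    · exact ⟨0, fun h => absurd h ht⟩
  choose Y hY using hex
  have hu := hc.tendstoUniformlyOn_of_tendsto hY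
  exact ⟨Y, hu.continuousOn (Frequently.of_forall hZ), hu⟩

section Mild

variable {X : Type*} [NormedAddCommGroup X] [InnerProductSpace ℂ X]

/-- Uniform limits of solutions are solutions, by dominated convergence. -/
lemma IsIntegralSolution.of_tendsto {T : ℝ} (hT : 0 ≤ T) {a q : ℝ → ℝ}
    (ha : MemLp a ∞ (timeMeasure T)) (hq : MemLp q ∞ (timeMeasure T)) {R S C₁ C₂ : X →L[ℂ] X}
    {F : ℕ → ℝ → X} {F' : ℝ → X} {U₀ W₀ : ℕ → X} {U₀' W₀' : X} {U W : ℕ → ℝ → X} {U' W' : ℝ → X}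
    (h : ∀ m, IsIntegralSolution R S C₁ C₂ T a q (F m) (U₀ m) (W₀ m) (U m) (W m))
    (hF : ∀ m, Integrable (F m) (timeMeasure T)) (hF' : Integrable F' (timeMeasure T))
    (hFle : ∀ m τ, ‖F m τ‖ ≤ ‖F' τ‖) (hFt : ∀ τ, Tendsto (fun m => F m τ) atTop (𝓝 (F' τ)))
    (hU₀ : Tendsto U₀ atTop (𝓝 U₀')) (hW₀ : Tendsto W₀ atTop (𝓝 W₀'))
    (hU : TendstoUniformlyOn U U' atTop (Icc 0 T)) (hW : TendstoUniformlyOn W W' atTop (Icc 0 T)) :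
    IsIntegralSolution R S C₁ C₂ T a q F' U₀' W₀' U' W' := by
  have h0 : (0 : ℝ) ∈ Icc 0 T := ⟨le_rfl, hT⟩
  have cU := hU.continuousOn (Frequently.of_forall fun m => (h m).continuousOn_fst)
  have cW := hW.continuousOn (Frequently.of_forall fun m => (h m).continuousOn_snd)
  have bound : ∀ {Z : ℕ → ℝ → X} {Y : ℝ → X}, TendstoUniformlyOn Z Y atTop (Icc 0 T) →
      ∀ᶠ m in atTop, ∀ t ∈ Icc 0 T, ‖Z m t‖ ≤ ‖Y t‖ + 1 := fun hZ => by
    filter_upwards [Metric.tendstoUniformlyOn_iff.1 hZ 1 one_pos] with m hm t ht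
    have := norm_sub_norm_le (_ : X) _ |>.trans ((dist_eq_norm_sub' _ _).symm.trans_lt (hm t ht)).le
    linarith
  have mono : ∀ {t : ℝ}, t ∈ Icc 0 T → ∀ {τ}, τ ∈ uIoc 0 t → τ ∈ Icc 0 T := fun ht τ hτ => by
    rw [uIoc_of_le ht.1] at hτ; exact ⟨hτ.1.le, hτ.2.trans ht.2⟩
  have ae : ∀ {p : ℝ → Prop}, (∀ᵐ τ ∂(timeMeasure T), p τ) → ∀ {t : ℝ}, t ∈ Icc 0 T →
      ∀ᵐ τ : ℝ, τ ∈ uIoc 0 t → p τ := fun hp t ht => by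
    filter_upwards [ae_timeMeasure_iff.1 hp] with τ h1 h2 using h1 (mono ht h2)
  have R0 : ∀ {Z : ℕ → X} {Y : X} (P : X →L[ℂ] X), Tendsto Z atTop (𝓝 Y) →
      Tendsto (fun m => P (Z m)) atTop (𝓝 (P Y)) := fun P hZ => (P.continuous.tendsto _).comp hZ
  refine ⟨cU, cW, fun t ht => ?_, fun t ht => ?_⟩
  · refine tendsto_nhds_unique (R0 R (hU.tendsto_at ht)) ?_
    simp only [fun m => (h m).fst_eq t ht]
    refine (R0 R hU₀).add (intervalIntegral.tendsto_integral_filter_of_dominated_convergence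
      (fun τ => ‖S‖ * (‖W' τ‖ + 1)) ?_ ?_ ?_ ?_)
    · exact Eventually.of_forall fun m => (intervalIntegrable_of_timeMeasure
        ((h m).continuousOn_snd.integrable_clm S) h0 ht).aestronglyMeasurable_restrict_uIoc
    · filter_upwards [bound hW] with m hm
      exact Eventually.of_forall fun τ hτ => S.le_opNorm_of_le (hm τ (mono ht hτ))
    · exact intervalIntegrable_of_timeMeasure
        ((cW.norm.add continuousOn_const).integrable_timeMeasure.const_mul _) h0 ht
    · exact Eventually.of_forall fun τ hτ => R0 S (hW.tendsto_at (mono ht hτ))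
  · refine tendsto_nhds_unique (R0 R (hW.tendsto_at ht)) ?_
    simp only [fun m => (h m).snd_eq t ht]
    refine (R0 R hW₀).add (intervalIntegral.tendsto_integral_filter_of_dominated_convergence
      (fun τ => ‖R‖ * ‖F' τ‖ + (normLInfty T a * ‖C₁‖ + normLInfty T q * ‖C₂‖) * (‖U' τ‖ + 1))
      ?_ ?_ ?_ ?_)
    · exact Eventually.of_forall fun m => (intervalIntegrable_of_timeMeasure
        (integrable_force ha hq (hF m) (h m).continuousOn_fst R C₁ C₂)
        h0 ht).aestronglyMeasurable_restrict_uIoc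
    · filter_upwards [bound hU] with m hm
      filter_upwards [ae (ae_norm_le_normLInfty ha) ht, ae (ae_norm_le_normLInfty hq) ht]
        with τ h1 h2 hτ
      have h3 := hm τ (mono ht hτ)
      refine (norm_sub_le _ _).trans ?_
      have e1 : ‖(a τ : ℂ) • C₁ (U m τ)‖ ≤ normLInfty T a * (‖C₁‖ * (‖U' τ‖ + 1)) := by
        rw [norm_smul, Complex.norm_real]
        exact mul_le_mul (h1 hτ) (C₁.le_opNorm_of_le h3) (norm_nonneg _) (normLInfty_nonneg _ _)
      have e2 : ‖(q τ : ℂ) • C₂ (U m τ)‖ ≤ normLInfty T q * (‖C₂‖ * (‖U' τ‖ + 1)) := by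
        rw [norm_smul, Complex.norm_real]
        exact mul_le_mul (h2 hτ) (C₂.le_opNorm_of_le h3) (norm_nonneg _) (normLInfty_nonneg _ _)
      have e3 := R.le_opNorm_of_le (hFle m τ)
      have e4 := norm_sub_le (R (F m τ)) ((a τ : ℂ) • C₁ (U m τ))
      linarith
    · exact (intervalIntegrable_of_timeMeasure (hF'.norm.const_mul _) h0 ht).add
        (intervalIntegrable_of_timeMeasure
          ((cU.norm.add continuousOn_const).integrable_timeMeasure.const_mul _) h0 ht)
    · refine Eventually.of_forall fun τ hτ => ?_
      have hUτ := hU.tendsto_at (mono ht hτ)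
      exact ((R0 R (hFt τ)).sub ((R0 C₁ hUτ).const_smul _)).sub ((R0 C₂ hUτ).const_smul _)

/-- The system `B U' = W`, `B W' = B F - a (1 - B²) U - q B² U`, integrated. For injective `B` it is
the equation `y'' + a (B⁻² - 1) y + q y = F`, with `U = B⁻¹ y` and `W = y'`. -/
abbrev IsMildSolution (B : X →L[ℂ] X) (T : ℝ) (a q : ℝ → ℝ) (F : ℝ → X) (U₀ W₀ : X)
    (U W : ℝ → X) : Prop :=
  IsIntegralSolution B 1 (1 - B * B) (B * B) T a q F U₀ W₀ U W

lemma energyConst_nonneg {T a₀ : ℝ} (ha₀ : 0 < a₀) (a q : ℝ → ℝ) : 0 ≤ energyConst T a₀ a q := by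
  have := normLInfty_nonneg T a
  have : 0 < min a₀ 1 := lt_min ha₀ one_pos
  rw [energyConst]
  positivity

variable [CompleteSpace X] {T : ℝ} {a q : ℝ → ℝ} {a₀ : ℝ} {B : X →L[ℂ] X}

/-- The energy estimate for the degenerate system. Multiplication by `max (B, δ)⁻¹ ψ (B)`, where
`ψ (B)` is a cutoff away from the kernel, turns it into a system with bounded operators, for which
the estimate does not depend on `δ`. -/
theorem IsMildSolution.energy_estimate (hT : 0 < T) (ha : MemLInftyOne T a)
    (ha₀ : 0 < a₀) (hinf : ∀ t ∈ Icc 0 T, a₀ ≤ a t) (hq : MemLp q ∞ (timeMeasure T))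
    (hB : 0 ≤ B) (hB1 : ∀ x, ‖B x‖ ≤ ‖x‖) (hinj : Function.Injective B)
    {F : ℝ → X} (hF : MemLp F 2 (timeMeasure T)) {U₀ W₀ : X} {U W : ℝ → X}
    (h : IsMildSolution B T a q F U₀ W₀ U W) {t : ℝ} (ht : t ∈ Icc 0 T) :
    ‖U t‖ ^ 2 + ‖W t‖ ^ 2 ≤
      energyConst T a₀ a q * (‖U₀‖ ^ 2 + ‖W₀‖ ^ 2 + ∫ τ in (0 : ℝ)..T, ‖F τ‖ ^ 2) := by
  refine le_of_tendsto (((tendsto_specCutoff hB hinj (U t)).norm.pow 2).add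
    ((tendsto_specCutoff hB hinj (W t)).norm.pow 2)) (Eventually.of_forall fun m => ?_)
  have hδ : (0 : ℝ) < 1 / ((m : ℝ) + 1) := by positivity
  set δ := 1 / ((m : ℝ) + 1)
  set Q := specCutoff B δ
  set D := truncInv B δ
  have hDQ : D * Q * B = Q := truncInv_mul_specCutoff hB hδ
  have hQB : Q * B = B * Q := commute_cfc hB _
  have hQle : ∀ x, ‖Q x‖ ≤ ‖x‖ := fun x => by
    simpa using Q.le_of_opNorm_le (norm_specCutoff_le B δ) x
  have hQF : MemLp (fun t => Q (F t)) 2 (timeMeasure T) := Q.comp_memLp' hF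
  have h1 : IsIntegralSolution 1 D (D - B) B T a q (fun t => Q (F t)) (Q U₀) (Q W₀)
      (fun t => Q (U t)) (fun t => Q (W t)) := by
    refine h.map ha.memLp hq (hF.integrable (by norm_num)) hT.le (D * Q) Q ?_ ?_ ?_ ?_
    · rw [hDQ, one_mul]
    · rw [mul_one]
    · rw [mul_sub, mul_one, ← mul_assoc, hDQ, hQB, sub_mul]
    · rw [← mul_assoc, hDQ, hQB]
  refine (DiscreteSchrodinger.energy_estimate hT ha ha₀ hinf hq truncInv_symm hB1 hQF h1
    ht).trans ?_
  have h0 : (0 : ℝ) ∈ Icc 0 T := ⟨le_rfl, hT.le⟩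
  have hTT : T ∈ Icc 0 T := ⟨hT.le, le_rfl⟩
  refine mul_le_mul_of_nonneg_left (add_le_add (add_le_add ?_ ?_) ?_) (energyConst_nonneg ha₀ a q)
  · exact pow_le_pow_left₀ (norm_nonneg _) (hQle _) 2
  · exact pow_le_pow_left₀ (norm_nonneg _) (hQle _) 2
  · exact intervalIntegral.integral_mono_on hT.le
      (intervalIntegrable_of_timeMeasure (integrable_norm_sq hQF) h0 hTT)
      (intervalIntegrable_of_timeMeasure (integrable_norm_sq hF) h0 hTT)
      fun τ _ => pow_le_pow_left₀ (norm_nonneg _) (hQle _) 2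

lemma IsMildSolution.unique (hT : 0 < T) (ha : MemLInftyOne T a)
    (ha₀ : 0 < a₀) (hinf : ∀ t ∈ Icc 0 T, a₀ ≤ a t) (hq : MemLp q ∞ (timeMeasure T))
    (hB : 0 ≤ B) (hB1 : ∀ x, ‖B x‖ ≤ ‖x‖) (hinj : Function.Injective B)
    {F : ℝ → X} (hF : MemLp F 2 (timeMeasure T)) {U₀ W₀ : X} {U W U' W' : ℝ → X}
    (h : IsMildSolution B T a q F U₀ W₀ U W) (h' : IsMildSolution B T a q F U₀ W₀ U' W')
    {t : ℝ} (ht : t ∈ Icc 0 T) : U t = U' t := by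
  have hF1 := hF.integrable (μ := timeMeasure T) (by norm_num)
  have h1 := IsMildSolution.energy_estimate hT ha ha₀ hinf hq hB hB1 hinj (hF.sub hF)
    (h.sub h' ha.memLp hq hF1 hF1 hT.le) ht
  simp only [Pi.sub_apply, sub_self, norm_zero, ne_eq, OfNat.ofNat_ne_zero, not_false_eq_true,
    zero_pow, intervalIntegral.integral_zero, add_zero, mul_zero] at h1
  have h2 : ‖U t - U' t‖ ^ 2 = 0 := le_antisymm (by linarith [sq_nonneg ‖W t - W' t‖]) (sq_nonneg _)
  rwa [sq_eq_zero_iff, norm_eq_zero, sub_eq_zero] at h2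

/-- Existence for data in the range of a cutoff: there the system with `max (B, δ)⁻¹` instead of
`B⁻¹` is equivalent to the original one, because its solution stays in the kernel of
`1 - B max (B, δ)⁻¹`. -/
lemma exists_isMildSolution_specCutoff (hT : 0 < T) (ha : MemLInftyOne T a)
    (ha₀ : 0 < a₀) (hinf : ∀ t ∈ Icc 0 T, a₀ ≤ a t) (hq : MemLp q ∞ (timeMeasure T))
    (hB : 0 ≤ B) (hB1 : ∀ x, ‖B x‖ ≤ ‖x‖) {δ : ℝ} (hδ : 0 < δ)
    {F : ℝ → X} (hF : MemLp F 2 (timeMeasure T)) (U₀ W₀ : X) :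
    ∃ U W, IsMildSolution B T a q (fun t => specCutoff B δ (F t)) (specCutoff B δ U₀)
      (specCutoff B δ W₀) U W := by
  set Q := specCutoff B δ
  set D := truncInv B δ
  have hDQ : D * Q * B = Q := truncInv_mul_specCutoff hB hδ
  have hQB : Q * B = B * Q := commute_cfc hB _
  have hDB : D * B = B * D := commute_cfc hB _
  have hQF : MemLp (fun t => Q (F t)) 2 (timeMeasure T) := Q.comp_memLp' hF
  have hQF1 := hQF.integrable (μ := timeMeasure T) (by norm_num)
  obtain ⟨U, W, h⟩ := exists_isIntegralSolution hT.le ha.memLp hq hQF1 D (D - B) B (Q U₀) (Q W₀)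
  have hN : ∀ x, (1 - B * D) (Q x) = 0 := fun x => by
    have : (1 - B * D) * Q = 0 := by
      rw [sub_mul, one_mul, ← hDB, mul_assoc, ← hQB, ← mul_assoc, hDQ, sub_self]
    exact DFunLike.congr_fun this x
  have hND : (1 - B * D) * D = D * (1 - B * D) := by
    rw [sub_mul, mul_sub, one_mul, mul_one, ← mul_assoc, hDB]
  have hNB : (1 - B * D) * B = B * (1 - B * D) := by
    rw [sub_mul, mul_sub, one_mul, mul_one, mul_assoc, hDB]
  have h1 := h.map ha.memLp hq hQF1 hT.le (1 - B * D) (1 - B * D)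
    (mul_one _ |>.trans (one_mul _).symm) hND (C₁' := D - B)
    (by rw [mul_sub, hND, hNB, sub_mul]) hNB
  simp only [hN] at h1
  have h2 : ∀ t ∈ Icc 0 T, B (D (U t)) = U t ∧ B (D (W t)) = W t := fun t ht => by
    have h3 := DiscreteSchrodinger.energy_estimate hT ha ha₀ hinf hq truncInv_symm hB1
      (memLp_const 0) h1 ht
    simp only [norm_zero, ne_eq, OfNat.ofNat_ne_zero, not_false_eq_true,
      zero_pow, intervalIntegral.integral_zero, add_zero, mul_zero] at h3
    have e1 : ‖(1 - B * D) (U t)‖ ^ 2 = 0 :=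
      le_antisymm (by linarith [sq_nonneg ‖(1 - B * D) (W t)‖]) (sq_nonneg _)
    have e2 : ‖(1 - B * D) (W t)‖ ^ 2 = 0 :=
      le_antisymm (by linarith [sq_nonneg ‖(1 - B * D) (U t)‖]) (sq_nonneg _)
    rw [sq_eq_zero_iff, norm_eq_zero] at e1 e2
    exact ⟨(sub_eq_zero.1 e1).symm, (sub_eq_zero.1 e2).symm⟩
  have h3 := h.map ha.memLp hq hQF1 hT.le B 1 (R' := B) (S' := B * D) (C₁' := B * (D - B))
    (C₂' := B * B) rfl rfl rfl rfl
  have mono : ∀ {t : ℝ}, t ∈ Icc 0 T → ∀ {τ}, τ ∈ uIcc 0 t → τ ∈ Icc 0 T := fun ht τ hτ => by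
    rw [uIcc_of_le ht.1] at hτ; exact ⟨hτ.1, hτ.2.trans ht.2⟩
  refine ⟨U, W, h.continuousOn_fst, h.continuousOn_snd, fun t ht => ?_, fun t ht => ?_⟩
  · refine (h3.fst_eq t ht).trans (congrArg _ (intervalIntegral.integral_congr fun τ hτ => ?_))
    exact (h2 τ (mono ht hτ)).2
  · refine (h3.snd_eq t ht).trans (congrArg _ (intervalIntegral.integral_congr fun τ hτ => ?_))
    change B (Q (F τ)) - (a τ : ℂ) • B (D (U τ) - B (U τ)) - (q τ : ℂ) • B (B (U τ)) =
      B (Q (F τ)) - (a τ : ℂ) • (U τ - B (B (U τ))) - (q τ : ℂ) • B (B (U τ))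
    rw [map_sub, (h2 τ (mono ht hτ)).1]

/-- Solutions for data in the range of the cutoffs converge, by the energy estimate. -/
theorem exists_isMildSolution (hT : 0 < T) (ha : MemLInftyOne T a)
    (ha₀ : 0 < a₀) (hinf : ∀ t ∈ Icc 0 T, a₀ ≤ a t) (hq : MemLp q ∞ (timeMeasure T))
    (hB : 0 ≤ B) (hB1 : ∀ x, ‖B x‖ ≤ ‖x‖) (hinj : Function.Injective B)
    {F : ℝ → X} (hF : MemLp F 2 (timeMeasure T)) (U₀ W₀ : X) :
    ∃ U W, IsMildSolution B T a q F U₀ W₀ U W := by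
  have h0 : (0 : ℝ) ∈ Icc 0 T := ⟨le_rfl, hT.le⟩
  have hTT : T ∈ Icc 0 T := ⟨hT.le, le_rfl⟩
  set Q : ℕ → X →L[ℂ] X := fun m => specCutoff B (1 / ((m : ℝ) + 1))
  have hQt : ∀ x, Tendsto (fun m => Q m x) atTop (𝓝 x) := tendsto_specCutoff hB hinj
  have hQle : ∀ m x, ‖Q m x‖ ≤ ‖x‖ := fun m x => by
    simpa using (Q m).le_of_opNorm_le (norm_specCutoff_le B _) x
  have hQF : ∀ m, MemLp (fun t => Q m (F t)) 2 (timeMeasure T) := fun m => (Q m).comp_memLp' hF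
  have hQF1 : ∀ m, Integrable (fun t => Q m (F t)) (timeMeasure T) := fun m =>
    (hQF m).integrable (by norm_num)
  choose U W h using fun m : ℕ => exists_isMildSolution_specCutoff hT ha ha₀ hinf hq hB hB1
    (δ := 1 / ((m : ℝ) + 1)) (by positivity) hF U₀ W₀
  have hi : ∀ {G : ℝ → X}, MemLp G 2 (timeMeasure T) →
      IntervalIntegrable (fun t => ‖G t‖ ^ 2) volume 0 T := fun hG =>
    intervalIntegrable_of_timeMeasure (integrable_norm_sq hG) h0 hTT
  have sq_tri : ∀ x y z : X, ‖x - y‖ ^ 2 ≤ 2 * ‖x - z‖ ^ 2 + 2 * ‖y - z‖ ^ 2 := fun x y z => by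
    have h1 : ‖x - y‖ ≤ ‖x - z‖ + ‖y - z‖ := by
      rw [norm_sub_rev y z]; exact norm_sub_le_norm_sub_add_norm_sub x z y
    nlinarith [sq_nonneg (‖x - z‖ - ‖y - z‖), norm_nonneg (x - y)]
  set δ : ℕ → ℝ := fun m =>
    ‖Q m U₀ - U₀‖ ^ 2 + ‖Q m W₀ - W₀‖ ^ 2 + ∫ τ in (0 : ℝ)..T, ‖Q m (F τ) - F τ‖ ^ 2 with hδdef
  have hδ : Tendsto δ atTop (𝓝 0) := by
    have hx : ∀ x, Tendsto (fun m => ‖Q m x - x‖ ^ 2) atTop (𝓝 0) := fun x => by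
      simpa using ((hQt x).sub_const x).norm.pow 2
    have hI : Tendsto (fun m => ∫ τ in (0 : ℝ)..T, ‖Q m (F τ) - F τ‖ ^ 2) atTop
        (𝓝 (∫ _ in (0 : ℝ)..T, (0 : ℝ))) := by
      refine intervalIntegral.tendsto_integral_filter_of_dominated_convergence
        (fun τ => 4 * ‖F τ‖ ^ 2) ?_ ?_ ((hi hF).const_mul 4) ?_
      · exact Eventually.of_forall fun m =>
          (hi ((hQF m).sub hF)).aestronglyMeasurable_restrict_uIoc
      · refine Eventually.of_forall fun m => Eventually.of_forall fun τ _ => ?_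
        rw [Real.norm_of_nonneg (sq_nonneg _)]
        have h1 := norm_sub_le (Q m (F τ)) (F τ)
        have h2 := hQle m (F τ)
        nlinarith [norm_nonneg (Q m (F τ) - F τ)]
      · exact Eventually.of_forall fun τ _ => hx (F τ)
    simpa using ((hx U₀).add (hx W₀)).add hI
  have key : ∀ m k, ∀ t ∈ Icc 0 T, ‖U m t - U k t‖ ^ 2 + ‖W m t - W k t‖ ^ 2 ≤
      energyConst T a₀ a q * 2 * (δ m + δ k) := fun m k t ht => by
    refine (IsMildSolution.energy_estimate hT ha ha₀ hinf hq hB hB1 hinj ((hQF m).sub (hQF k))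
      ((h m).sub (h k) ha.memLp hq (hQF1 m) (hQF1 k) hT.le) ht).trans ?_
    rw [mul_assoc]
    refine mul_le_mul_of_nonneg_left ?_ (energyConst_nonneg ha₀ a q)
    have hd : ∀ m, IntervalIntegrable (fun τ => 2 * ‖Q m (F τ) - F τ‖ ^ 2) volume 0 T := fun m =>
      (hi ((hQF m).sub hF)).const_mul 2
    have e : ∫ τ in (0 : ℝ)..T, ‖Q m (F τ) - Q k (F τ)‖ ^ 2 ≤
        2 * (∫ τ in (0 : ℝ)..T, ‖Q m (F τ) - F τ‖ ^ 2) +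
          2 * ∫ τ in (0 : ℝ)..T, ‖Q k (F τ) - F τ‖ ^ 2 := by
      rw [← intervalIntegral.integral_const_mul, ← intervalIntegral.integral_const_mul,
        ← intervalIntegral.integral_add (hd m) (hd k)]
      exact intervalIntegral.integral_mono_on hT.le (hi ((hQF m).sub (hQF k)))
        ((hd m).add (hd k)) fun τ _ => sq_tri _ _ _
    have e1 := sq_tri (Q m U₀) (Q k U₀) U₀
    have e2 := sq_tri (Q m W₀) (Q k W₀) W₀
    simp only [hδdef, Pi.sub_apply]
    linarith
  obtain ⟨U', -, hU'⟩ := exists_tendstoUniformlyOn (fun m => (h m).continuousOn_fst) hδ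
    fun m k t ht => (le_add_of_nonneg_right (sq_nonneg _)).trans (key m k t ht)
  obtain ⟨W', -, hW'⟩ := exists_tendstoUniformlyOn (fun m => (h m).continuousOn_snd) hδ
    fun m k t ht => (le_add_of_nonneg_left (sq_nonneg _)).trans (key m k t ht)
  exact ⟨U', W', IsIntegralSolution.of_tendsto hT.le ha.memLp hq h hQF1
    (hF.integrable (by norm_num)) (fun m τ => hQle m (F τ)) (fun τ => hQt (F τ)) (hQt U₀) (hQt W₀)
    hU' hW'⟩

end Mild

/-! ### Strong, weak and integrated forms of the equation -/

section Forms

variable {X : Type*} [NormedAddCommGroup X] [InnerProductSpace ℂ X] {T : ℝ}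

lemma absolutelyContinuousOnInterval_inner (hT : 0 ≤ T) {P G : ℝ → X} {x₀ : X}
    (hG : Integrable G (timeMeasure T))
    (h : ∀ t ∈ Icc 0 T, P t = x₀ + ∫ τ in (0 : ℝ)..t, G τ) (χ : X) :
    AbsolutelyContinuousOnInterval (fun t => ⟪χ, P t⟫_ℂ) 0 T := by
  refine absolutelyContinuousOnInterval_of_dist_le (C := ‖χ‖)
    (absolutelyContinuousOnInterval_integral hT hG x₀) fun x hx y hy => ?_
  rw [uIcc_of_le hT] at hx hy
  rw [← h x hx, ← h y hy, dist_eq_norm, dist_eq_norm, ← inner_sub_right]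
  exact norm_inner_le_norm _ _

variable [CompleteSpace X]

/-- Weak solutions are integrated solutions: it is enough to test with a set of vectors that
separates points. -/
lemma eq_integral_of_weak (hT : 0 ≤ T) {P G : ℝ → X} (hG : Integrable G (timeMeasure T))
    {S : Set X} (hS : ∀ g, (∀ χ ∈ S, ⟪χ, g⟫_ℂ = 0) → g = 0)
    (hac : ∀ χ ∈ S, AbsolutelyContinuousOnInterval (fun t => ⟪χ, P t⟫_ℂ) 0 T)
    (hder : ∀ χ ∈ S, ∀ᵐ t ∂(timeMeasure T),
      HasDerivAt (fun t => ⟪χ, P t⟫_ℂ) ⟪χ, G t⟫_ℂ t) {t : ℝ} (ht : t ∈ Icc 0 T) :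
    P t = P 0 + ∫ τ in (0 : ℝ)..t, G τ := by
  rw [← sub_eq_zero]
  refine hS _ fun χ hχ => ?_
  have h0 : (0 : ℝ) ∈ Icc 0 T := ⟨le_rfl, hT⟩
  have h1 := eq_integral_of_absolutelyContinuousOnInterval hT (hac χ hχ)
    ((innerSL ℂ χ).integrable_comp hG) (hder χ hχ) ht
  have h2 := (innerSL ℂ χ).intervalIntegral_comp_comm (intervalIntegrable_of_timeMeasure hG h0 ht)
  simp only [innerSL_apply_apply] at h1 h2
  rw [inner_sub_right, inner_add_right, ← h2, h1, sub_self]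

lemma ae_hasDerivAt_inner (hT : 0 ≤ T) {P G : ℝ → X} {x₀ : X} (hG : Integrable G (timeMeasure T))
    (h : ∀ t ∈ Icc 0 T, P t = x₀ + ∫ τ in (0 : ℝ)..t, G τ) (χ : X) :
    ∀ᵐ t ∂(timeMeasure T), HasDerivAt (fun t => ⟪χ, P t⟫_ℂ) ⟪χ, G t⟫_ℂ t := by
  filter_upwards [ae_hasDerivAt_integral hT hG h] with t ht
  exact ((innerSL ℂ χ).restrictScalars ℝ).hasFDerivAt.comp_hasDerivAt t ht

variable {Y : Type*} [NormedAddCommGroup Y] [NormedSpace ℂ Y]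

lemma eq_integral_of_contDiffOn (hT : 0 < T) (J : Y ≃ₗᵢ[ℂ] X) {y : ℝ → Y}
    (hy : ContDiffOn ℝ 1 y (Icc 0 T)) {t : ℝ} (ht : t ∈ Icc 0 T) :
    J (y t) = J (y 0) + ∫ τ in (0 : ℝ)..t, J (derivWithin y (Icc 0 T) τ) := by
  refine eq_integral_of_absolutelyContinuousOnInterval (f := fun t => J (y t)) hT.le
    (absolutelyContinuousOnInterval_of_dist_le (C := 1) (g := y) ?_ fun a _ b _ => by simp)
    (J.continuous.comp_continuousOn
      (hy.continuousOn_derivWithin (uniqueDiffOn_Icc hT) le_rfl)).integrable_timeMeasure ?_ ht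
  · rw [← uIcc_of_le hT.le] at hy
    exact hy.absolutelyContinuousOnInterval
  · filter_upwards [ae_mem_Ioo_timeMeasure] with τ hτ
    have h1 := ((hy.differentiableOn one_ne_zero τ
      (Ioo_subset_Icc_self hτ)).hasDerivWithinAt).hasDerivAt (Icc_mem_nhds hτ.1 hτ.2)
    exact ((J : Y →L[ℂ] X).restrictScalars ℝ).hasFDerivAt.comp_hasDerivAt τ h1

lemma hasDerivWithinAt_of_eq_integral (J : Y ≃ₗᵢ[ℂ] X) {y : ℝ → Y} {W : ℝ → X}
    {x₀ : X} (hW : ContinuousOn W (Icc 0 T))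
    (h : ∀ t ∈ Icc 0 T, J (y t) = x₀ + ∫ τ in (0 : ℝ)..t, W τ) {t : ℝ} (ht : t ∈ Icc 0 T) :
    HasDerivWithinAt y (J.symm (W t)) (Icc 0 T) t := by
  have h0 : (0 : ℝ) ∈ Icc 0 T := ⟨le_rfl, ht.1.trans ht.2⟩
  have : Fact (t ∈ Icc 0 T) := ⟨ht⟩
  have h1 : HasDerivWithinAt (fun t => ∫ τ in (0 : ℝ)..t, W τ) (W t) (Icc 0 T) t :=
    intervalIntegral.integral_hasDerivWithinAt_right
      (intervalIntegrable_of_timeMeasure hW.integrable_timeMeasure h0 ht)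
      (hW.stronglyMeasurableAtFilter_nhdsWithin measurableSet_Icc t) (hW t ht)
  have h2 : HasDerivWithinAt (fun t => J (y t)) (W t) (Icc 0 T) t :=
    (h1.const_add x₀).congr h (h t ht)
  have h3 := ((J.symm : X →L[ℂ] Y).restrictScalars ℝ).hasFDerivAt.comp_hasDerivWithinAt t h2
  refine h3.congr_of_eventuallyEq (Eventually.of_forall fun τ => ?_) ?_ <;> simp

end Forms

/-! ### Sobolev spaces as copies of `ℓ²` -/

section Sobolev

variable {n : ℕ} {ħ : ℝ} (V : lattice n ħ → ℝ≥0)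

/-- `(I + 𝓗)⁻¹` is a contraction, because `(v, (I + 𝓗) v) ≥ ‖v‖²`. -/
lemma norm_resolvent_le (g : L2 n ħ) : ‖resolvent V g‖ ≤ ‖g‖ := by
  set v := resolvent V g with hv
  have h2 : ‖⟪v, hopping v⟫_ℂ‖ ≤ (ħ ^ 2)⁻¹ * (2 * n) * ‖v‖ ^ 2 := by
    refine (norm_inner_le_norm _ _).trans ?_
    have := hopping.le_of_opNorm_le (norm_hopping_le (n := n) (ħ := ħ)) v
    nlinarith [norm_nonneg v]
  have h3 : (1 + (ħ ^ 2)⁻¹ * (2 * n)) * ‖v‖ ^ 2 ≤ (⟪v, g + hopping v⟫_ℂ).re := by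
    have e1 := Complex.hasSum_re (lp.hasSum_inner v v)
    have e2 := Complex.hasSum_re (lp.hasSum_inner v (g + hopping v))
    have e3 : (⟪v, v⟫_ℂ).re = ‖v‖ ^ 2 := (norm_sq_eq_re_inner (𝕜 := ℂ) v).symm
    rw [e3] at e1
    refine hasSum_le (fun k => ?_) (e1.mul_left _) e2
    have hk := congrFun (one_add_resolvent V g) k
    rw [one_add_hamiltonian_apply] at hk
    rw [lp.coeFn_add, Pi.add_apply, ← hk]
    simp only [RCLike.inner_apply, sub_add_cancel, ← hv]
    rw [mul_assoc, Complex.mul_conj, ← Complex.ofReal_mul, Complex.ofReal_re, Complex.ofReal_re]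
    exact mul_le_mul_of_nonneg_right (diag_ge V k) (Complex.normSq_nonneg _)
  rw [inner_add_right, Complex.add_re] at h3
  have h4 := (Complex.re_le_norm ⟪v, hopping v⟫_ℂ).trans h2
  have h5 := (Complex.re_le_norm ⟪v, g⟫_ℂ).trans (norm_inner_le_norm v g)
  have h6 : ‖v‖ * ‖v‖ ≤ ‖v‖ * ‖g‖ := by nlinarith
  rcases (norm_nonneg v).eq_or_lt with h | h
  · rw [← h]; exact norm_nonneg g
  · exact le_of_mul_le_mul_left h6 h

lemma negPow_half_mul_self : negPow V (1 / 2) * negPow V (1 / 2) = resolvent V := by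
  rw [← negPow_add V (by norm_num) (by norm_num), add_halves, ← Nat.cast_one, negPow_natCast,
    pow_one]

lemma norm_negPow_half_le (g : L2 n ħ) : ‖negPow V (1 / 2) g‖ ≤ ‖g‖ := by
  refine le_of_sq_le_sq ?_ (norm_nonneg g)
  have h : ‖negPow V (1 / 2) g‖ ^ 2 = (⟪g, resolvent V g⟫_ℂ).re := by
    rw [← negPow_half_mul_self, mul_apply_eq_comp, ← inner_negPow]
    exact norm_sq_eq_re_inner (𝕜 := ℂ) _
  rw [h, sq]
  exact (Complex.re_le_norm _).trans ((norm_inner_le_norm _ _).trans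
    (mul_le_mul_of_nonneg_left (norm_resolvent_le V g) (norm_nonneg g)))

lemma negPow_half_injective : Function.Injective (negPow V (1 / 2)) := fun g h hgh => by
  apply resolvent_pow_injective V 1
  rw [pow_one, ← negPow_half_mul_self, mul_apply_eq_comp, mul_apply_eq_comp, hgh]

lemma sobolevToL2_surjective (r : ℝ) : Function.Surjective (sobolevToL2 V r) := fun g => by
  have h : realPowDist V (r / 2) (realPowDist V (-(r / 2)) (ofL2 V g)) = ofL2 V g := by
    ext φ
    change (ofL2 V g).1 (realPow V (-(r / 2)) (realPow V (r / 2) φ)) = (ofL2 V g).1 φ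
    rw [realPow_realPow, neg_add_cancel, realPow_zero]
  exact ⟨⟨_, g, h.symm⟩, ofL2_injective V ((ofL2_sobolevToL2 V r _).trans h)⟩

/-- The isometry `(I + 𝓗)^(r/2)` from `H^r` onto `ℓ²`. -/
noncomputable def sobolevEquiv (r : ℝ) : sobolev V r ≃ₗᵢ[ℂ] L2 n ħ :=
  LinearIsometryEquiv.ofSurjective ⟨sobolevToL2 V r, fun _ => rfl⟩ (sobolevToL2_surjective V r)

lemma pairing_realPow {r : ℝ} (w : sobolev V r) (φ : testSpace V) :
    pairing (w : distribution V) (realPow V (r / 2) φ) = ⟪(φ : L2 n ħ), sobolevEquiv V r w⟫_ℂ :=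
  (congrArg (fun v => pairing v φ) (ofL2_sobolevToL2 V r w)).symm

lemma eq_zero_of_inner_testSpace (g : L2 n ħ)
    (h : ∀ χ ∈ (testSpace V : Set (L2 n ħ)), ⟪χ, g⟫_ℂ = 0) : g = 0 := by
  apply ofL2_injective V
  rw [map_zero]
  ext φ
  exact h φ φ.2

/-- On test functions, the two definitions of `(I + 𝓗)^(-1/2)` agree. -/
lemma realPow_neg_half (φ : testSpace V) :
    (realPow V (-(1 / 2)) φ : L2 n ħ) = negPow V (1 / 2) φ := by
  have := resolvent_pow_realPow V (r := -(1 / 2)) (m := 0) (by norm_num) φ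
  rwa [Nat.cast_zero, zero_sub, neg_neg, pow_zero] at this

lemma coe_sobolevIncl {s : ℝ} (w : sobolev V (1 + s)) :
    (sobolevIncl V s w : distribution V) = w :=
  Submodule.coe_inclusion (sobolev_one_add_le V s) w

lemma sobolevEquiv_sobolevIncl {s : ℝ} (w : sobolev V (1 + s)) :
    sobolevEquiv V s (sobolevIncl V s w) = negPow V (1 / 2) (sobolevEquiv V (1 + s) w) := by
  refine sub_eq_zero.1 (eq_zero_of_inner_testSpace V _ fun φ hφ => ?_)
  have h1 := pairing_realPow V (sobolevIncl V s w) ⟨φ, hφ⟩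
  have h2 := pairing_realPow V w (realPow V (-(1 / 2)) ⟨φ, hφ⟩)
  rw [coe_sobolevIncl] at h1
  rw [realPow_realPow, show (1 + s) / 2 + -(1 / 2) = s / 2 by ring, realPow_neg_half,
    inner_negPow] at h2
  rw [inner_sub_right, sub_eq_zero]
  exact h1.symm.trans h2

lemma hamiltonianTest_eq (φ : testSpace V) : hamiltonianTest V φ = realPow V 1 φ - φ := by
  have h1 : powTest V 1 φ = realPow V 1 φ := by
    rw [powTest_eq_iff]
    have := resolvent_pow_realPow V (r := 1) (m := 1) (by simp) φ
    rwa [Nat.cast_one, sub_self, negPow_zero] at this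
  ext1
  have h2 := powTest_hamiltonianTest V 0 φ
  rw [powTest_zero, powTest_zero, zero_add, h1] at h2
  exact h2

variable (s : ℝ)

/-- The pairing with the test function `(I + 𝓗)^(-(1-s)/2) χ` in terms of the coordinates in `ℓ²`;
this exponent makes the action of `𝓗` on `H^{1+s}`, in `pairing_hamiltonianDist_eq_inner`,
bounded. -/
lemma pairing_eq_inner (w : sobolev V s) (χ : testSpace V) :
    pairing (w : distribution V) (realPow V (-((1 - s) / 2)) χ) =
      ⟪(χ : L2 n ħ), negPow V (1 / 2) (sobolevEquiv V s w)⟫_ℂ := by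
  rw [← inner_negPow, ← realPow_neg_half, ← pairing_realPow, realPow_realPow,
    show s / 2 + -(1 / 2) = -((1 - s) / 2) by ring]

lemma pairing_one_add_eq_inner (w : sobolev V (1 + s)) (χ : testSpace V) :
    pairing (w : distribution V) (realPow V (-((1 - s) / 2)) χ) = ⟪(χ : L2 n ħ),
      (negPow V (1 / 2) * negPow V (1 / 2)) (sobolevEquiv V (1 + s) w)⟫_ℂ := by
  rw [mul_apply_eq_comp, ← sobolevEquiv_sobolevIncl, ← pairing_eq_inner, coe_sobolevIncl]

lemma pairing_hamiltonianDist_eq_inner (w : sobolev V (1 + s)) (χ : testSpace V) :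
    pairing (hamiltonianDist V (w : distribution V)) (realPow V (-((1 - s) / 2)) χ) =
      ⟪(χ : L2 n ħ),
        (1 - negPow V (1 / 2) * negPow V (1 / 2)) (sobolevEquiv V (1 + s) w)⟫_ℂ := by
  change pairing (w : distribution V) (hamiltonianTest V _) = _
  rw [sub_apply, inner_sub_right, ← pairing_one_add_eq_inner, one_apply_eq_self,
    ← pairing_realPow, hamiltonianTest_eq, realPow_realPow,
    show 1 + -((1 - s) / 2) = (1 + s) / 2 by ring]
  exact map_sub (w : distribution V).1 _ _

end Sobolev

/-! ### Solutions of the Cauchy problem and of the degenerate system -/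

section Translation

variable {n : ℕ} {ħ : ℝ} {V : lattice n ħ → ℝ≥0} {s T : ℝ} {a q : ℝ → ℝ} {f : ℝ → sobolev V s}
  {u₀ : sobolev V (1 + s)} {u₁ : sobolev V s}

/-- The algebra behind `equation_iff`, with the pairings as free variables, so that pairings on
`H^s` and on `H^{1+s}` are never unified with each other. -/
lemma add_mul_add_mul_eq_iff_eq_inner {X : Type*} [NormedAddCommGroup X] [InnerProductSpace ℂ X]
    {χ g₁ g₂ g₃ : X} {x₁ x₂ x₃ : ℂ} (h₁ : x₁ = ⟪χ, g₁⟫_ℂ) (h₂ : x₂ = ⟪χ, g₂⟫_ℂ)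
    (h₃ : x₃ = ⟪χ, g₃⟫_ℂ) (z α ρ : ℂ) :
    z + α * x₁ + ρ * x₂ = x₃ ↔ z = ⟪χ, g₃ - α • g₁ - ρ • g₂⟫_ℂ := by
  rw [inner_sub_right, inner_sub_right, inner_smul_right, inner_smul_right, ← h₁, ← h₂, ← h₃,
    sub_sub, eq_sub_iff_add_eq, add_assoc]

/-- The equation at a fixed time, tested with `(I + 𝓗)^(-(1-s)/2) χ`, in coordinates in `ℓ²`. -/
lemma equation_iff (w : sobolev V (1 + s)) (v : sobolev V s) (χ : testSpace V) (z α ρ : ℂ) :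
    z + α * pairing (hamiltonianDist V (w : distribution V)) (realPow V (-((1 - s) / 2)) χ)
      + ρ * pairing (w : distribution V) (realPow V (-((1 - s) / 2)) χ) =
        pairing (v : distribution V) (realPow V (-((1 - s) / 2)) χ) ↔
    z = ⟪(χ : L2 n ħ), negPow V (1 / 2) (sobolevEquiv V s v) -
      α • (1 - negPow V (1 / 2) * negPow V (1 / 2)) (sobolevEquiv V (1 + s) w) -
      ρ • (negPow V (1 / 2) * negPow V (1 / 2)) (sobolevEquiv V (1 + s) w)⟫_ℂ :=
  add_mul_add_mul_eq_iff_eq_inner (pairing_hamiltonianDist_eq_inner V s w χ)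
    (pairing_one_add_eq_inner V s w χ) (pairing_eq_inner V s v χ) z α ρ

lemma IsSolution.isMildSolution {u : ℝ → sobolev V (1 + s)} (hT : 0 < T)
    (ha : MemLp a ∞ (timeMeasure T)) (hq : MemLp q ∞ (timeMeasure T))
    (hf : Integrable (fun t => sobolevEquiv V s (f t)) (timeMeasure T))
    (h : IsSolution V s T a q f u₀ u₁ u) :
    IsMildSolution (negPow V (1 / 2)) T a q (fun t => sobolevEquiv V s (f t))
      (sobolevEquiv V (1 + s) u₀) (sobolevEquiv V s u₁) (fun t => sobolevEquiv V (1 + s) (u t))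
      (fun t => sobolevEquiv V s (timeDeriv T u t)) := by
  have cU := (sobolevEquiv V (1 + s)).continuous.comp_continuousOn h.continuousOn
  refine ⟨cU, (sobolevEquiv V s).continuous.comp_continuousOn
    (h.contDiffOn.continuousOn_derivWithin (uniqueDiffOn_Icc hT) le_rfl), fun t ht => ?_,
    fun t ht => ?_⟩
  · rw [← h.initial, ← sobolevEquiv_sobolevIncl, ← sobolevEquiv_sobolevIncl]
    exact eq_integral_of_contDiffOn hT (sobolevEquiv V s) h.contDiffOn ht
  · have e : ∀ (χ : testSpace V) t, pairing (timeDeriv T u t : distribution V)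
        (realPow V (-((1 - s) / 2)) χ) =
          ⟪(χ : L2 n ħ), negPow V (1 / 2) (sobolevEquiv V s (timeDeriv T u t))⟫_ℂ := fun χ t =>
      pairing_eq_inner V s _ χ
    rw [← h.initial_deriv]
    refine eq_integral_of_weak (P := fun t => negPow V (1 / 2) (sobolevEquiv V s (timeDeriv T u t)))
      hT.le (integrable_force ha hq hf cU _ _ _)
      (eq_zero_of_inner_testSpace V) (fun χ hχ => ?_) (fun χ hχ => ?_) ht
    · have := h.absolutelyContinuous (realPow V (-((1 - s) / 2)) ⟨χ, hχ⟩)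
      simpa only [e] using this
    · filter_upwards [h.equation (realPow V (-((1 - s) / 2)) ⟨χ, hχ⟩)] with t ht
      obtain ⟨z, hz, hz'⟩ := ht
      simp only [e] at hz
      exact hz.congr_deriv ((equation_iff (u t) (f t) ⟨χ, hχ⟩ z _ _).1 hz')

lemma IsMildSolution.isSolution {u : ℝ → sobolev V (1 + s)} {v : ℝ → sobolev V s} (hT : 0 < T)
    (ha : MemLp a ∞ (timeMeasure T)) (hq : MemLp q ∞ (timeMeasure T))
    (hf : Integrable (fun t => sobolevEquiv V s (f t)) (timeMeasure T))
    (h : IsMildSolution (negPow V (1 / 2)) T a q (fun t => sobolevEquiv V s (f t))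
      (sobolevEquiv V (1 + s) u₀) (sobolevEquiv V s u₁) (fun t => sobolevEquiv V (1 + s) (u t))
      (fun t => sobolevEquiv V s (v t))) :
    IsSolution V s T a q f u₀ u₁ u ∧ ∀ t ∈ Icc 0 T, timeDeriv T u t = v t := by
  have h0 : (0 : ℝ) ∈ Icc 0 T := ⟨le_rfl, hT.le⟩
  have hy : ∀ t ∈ Icc 0 T,
      HasDerivWithinAt (fun t => sobolevIncl V s (u t)) (v t) (Icc 0 T) t := fun t ht => by
    have := hasDerivWithinAt_of_eq_integral (sobolevEquiv V s) h.continuousOn_snd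
      (y := fun t => sobolevIncl V s (u t))
      (fun t ht => (sobolevEquiv_sobolevIncl V (u t)).trans (h.fst_eq t ht)) ht
    exact this.congr_deriv (LinearIsometryEquiv.symm_apply_apply _ _)
  have hd : ∀ t ∈ Icc 0 T, timeDeriv T u t = v t := fun t ht =>
    (hy t ht).derivWithin (uniqueDiffOn_Icc hT t ht)
  have hG := integrable_force ha hq hf h.continuousOn_fst (negPow V (1 / 2))
    (1 - negPow V (1 / 2) * negPow V (1 / 2)) (negPow V (1 / 2) * negPow V (1 / 2))
  have e : ∀ φ : testSpace V, ∃ χ : testSpace V, realPow V (-((1 - s) / 2)) χ = φ := fun φ =>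
    ⟨realPow V ((1 - s) / 2) φ, by rw [realPow_realPow, neg_add_cancel, realPow_zero]⟩
  have hp : ∀ χ : testSpace V, EqOn (fun t => pairing (timeDeriv T u t : distribution V)
      (realPow V (-((1 - s) / 2)) χ))
      (fun t => ⟪(χ : L2 n ħ), negPow V (1 / 2) (sobolevEquiv V s (v t))⟫_ℂ)
      (Icc 0 T) := fun χ t ht =>
    (congrArg (fun w : sobolev V s => pairing (w : distribution V)
      (realPow V (-((1 - s) / 2)) χ)) (hd t ht)).trans (pairing_eq_inner V s (v t) χ)
  refine ⟨⟨?_, ?_, fun φ => ?_, fun φ => ?_, ?_, ?_⟩, hd⟩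
  · exact ((sobolevEquiv V (1 + s)).symm.continuous.comp_continuousOn h.continuousOn_fst).congr
      fun t _ => ((sobolevEquiv V (1 + s)).symm_apply_apply (u t)).symm
  · rw [contDiffOn_one_iff_derivWithin (uniqueDiffOn_Icc hT)]
    refine ⟨fun t ht => (hy t ht).differentiableWithinAt, ContinuousOn.congr (f := v) ?_ hd⟩
    exact ((sobolevEquiv V s).symm.continuous.comp_continuousOn h.continuousOn_snd).congr
      fun t _ => ((sobolevEquiv V s).symm_apply_apply (v t)).symm
  · obtain ⟨χ, rfl⟩ := e φ
    refine absolutelyContinuousOnInterval_congr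
      (absolutelyContinuousOnInterval_inner hT.le hG h.snd_eq (χ : L2 n ħ)) ?_
    rw [uIcc_of_le hT.le]
    exact hp χ
  · obtain ⟨χ, rfl⟩ := e φ
    filter_upwards [ae_hasDerivAt_inner hT.le hG h.snd_eq (χ : L2 n ħ), ae_mem_Ioo_timeMeasure]
      with t ht ht'
    refine ⟨_, ht.congr_of_eventuallyEq ?_, (equation_iff (u t) (f t) χ _ (a t) (q t)).2 rfl⟩
    filter_upwards [Icc_mem_nhds ht'.1 ht'.2] with τ hτ using hp χ hτ
  · apply (sobolevEquiv V (1 + s)).injective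
    apply negPow_half_injective V
    exact h.fst_zero hT.le
  · refine (hd 0 h0).trans ?_
    apply (sobolevEquiv V s).injective
    apply negPow_half_injective V
    exact h.snd_zero hT.le

lemma integral_norm_sq_eq_normL2 (hT : 0 ≤ T) (hf : MemLp f 2 (timeMeasure T)) :
    ∫ τ in (0 : ℝ)..T, ‖f τ‖ ^ 2 = normL2 T f ^ 2 := by
  have h0 : 0 ≤ ∫ τ, ‖f τ‖ ^ 2 ∂(timeMeasure T) := integral_nonneg fun _ => sq_nonneg _
  rw [intervalIntegral.integral_of_le hT, ← integral_Icc_eq_integral_Ioc, normL2,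
    hf.eLpNorm_eq_integral_rpow_norm (by norm_num) (by norm_num)]
  simp only [ENNReal.toReal_ofNat, Real.rpow_ofNat]
  rw [ENNReal.toReal_ofReal (by positivity), ← Real.rpow_natCast, ← Real.rpow_mul h0]
  norm_num
  rfl

end Translation

end DiscreteSchrodinger

open DiscreteSchrodinger in
theorem theorem2p1 (n : ℕ) (ħ : ℝ) (hħ : 0 < ħ) (V : lattice n ħ → ℝ≥0) (T : ℝ) (hT : 0 < T)
    (s : ℝ) (f : ℝ → sobolev V s) (hf : MemLp f 2 (timeMeasure T))
    (a : ℝ → ℝ) (ha : MemLInftyOne T a) (a₀ : ℝ) (ha₀ : 0 < a₀) (hinf : IsGLB (a '' Icc 0 T) a₀)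
    (q : ℝ → ℝ) (hq : MemLp q ∞ (timeMeasure T))
    (u₀ : sobolev V (1 + s)) (u₁ : sobolev V s) :
    ∃ u : ℝ → sobolev V (1 + s),
      IsSolution V s T a q f u₀ u₁ u ∧
      (∀ w : ℝ → sobolev V (1 + s), IsSolution V s T a q f u₀ u₁ w → EqOn w u (Icc 0 T)) ∧
      ∀ t ∈ Icc 0 T, ‖u t‖ ^ 2 + ‖timeDeriv T u t‖ ^ 2 ≤
        energyConst T a₀ a q * (‖u₀‖ ^ 2 + ‖u₁‖ ^ 2 + normL2 T f ^ 2) := by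
  have hlow : ∀ t ∈ Icc 0 T, a₀ ≤ a t := fun t ht => hinf.1 (mem_image_of_mem a ht)
  have hB : 0 ≤ negPow V (1 / 2) := opPow_nonneg _ _
  have hF : MemLp (fun t => sobolevEquiv V s (f t)) 2 (timeMeasure T) :=
    ((sobolevEquiv V s : sobolev V s →L[ℂ] L2 n ħ)).comp_memLp' hf
  have hF1 := hF.integrable (μ := timeMeasure T) (by norm_num)
  obtain ⟨U, W, h⟩ := exists_isMildSolution hT ha ha₀ hlow hq hB (norm_negPow_half_le V)
    (negPow_half_injective V) hF (sobolevEquiv V (1 + s) u₀) (sobolevEquiv V s u₁)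
  obtain ⟨u, rfl⟩ : ∃ u : ℝ → sobolev V (1 + s), U = fun t => sobolevEquiv V (1 + s) (u t) :=
    ⟨fun t => (sobolevEquiv V (1 + s)).symm (U t),
      funext fun t => ((sobolevEquiv V (1 + s)).apply_symm_apply (U t)).symm⟩
  obtain ⟨v, rfl⟩ : ∃ v : ℝ → sobolev V s, W = fun t => sobolevEquiv V s (v t) :=
    ⟨fun t => (sobolevEquiv V s).symm (W t),
      funext fun t => ((sobolevEquiv V s).apply_symm_apply (W t)).symm⟩
  obtain ⟨hsol, hd⟩ := h.isSolution hT ha.memLp hq hF1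
  refine ⟨u, hsol, fun w hw t ht => ?_, fun t ht => ?_⟩
  · exact (sobolevEquiv V (1 + s)).injective ((hw.isMildSolution hT ha.memLp hq hF1).unique hT ha
      ha₀ hlow hq hB (norm_negPow_half_le V) (negPow_half_injective V) hF h ht)
  · have h1 := h.energy_estimate hT ha ha₀ hlow hq hB (norm_negPow_half_le V)
      (negPow_half_injective V) hF ht
    simp only [LinearIsometryEquiv.norm_map] at h1
    rw [integral_norm_sq_eq_normL2 hT.le hf] at h1
    exact (congrArg (fun x : sobolev V s => ‖u t‖ ^ 2 + ‖x‖ ^ 2) (hd t ht)).trans_le h1
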